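/- Let $\mathcal{H}$ be a Hilbert space, let $\mathcal{K}$ be the $C^*$-algebra of all compact operators on $\mathcal{H}$, and let $E$ be a (left) Hilbert $\mathcal{K}$-module. Denote by $B(E)$ the adjointable operators on $E$ and by $K(E)\subseteq B(E)$ the closed linear span of the operators $\Theta_{x,y}(z)=\langle z,x\rangle y$, $x,y\in E$. An operator $T\in B(E)$ is called Fredholm if there are $S_1,S_2\in B(E)$ with $S_1T-1\in K(E)$ and $TS_2-1\in K(E)$. A densely defined closed $\mathcal{K}$-linear operator $t:\mathrm{Dom}(t)\subseteq E\to E$ is called regular if its adjoint $t^*$ is densely defined and $1+t^*t$ has dense range. A regular operator $t$ is called Fredholm if there are $G_1,G_2\in B(E)$ such that $G_1t$ and $tG_2$ are closable, their closures belong to $B(E)$, and $\overline{G_1t}-1\in K(E)$, $\overline{tG_2}-1\in K(E)$. An orthonormal basis of a closed submodule $X\subseteq E$ is a family of pairwise orthogonal vectors $x_\lambda\in X$ that generates a dense submodule of $X$ and for which every $\langle x_\lambda,x_\lambda\rangle$ is a minimal projection of $\mathcal{K}$. The dimension $\dim_{\mathcal{K}}X$ is the cardinality of any orthonormal basis of $X$.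 Let $t$ be a regular Fredholm operator on $E$. Then the bounded transform $F_t=t(1+t^*t)^{-1/2}$ exists (and is unique) as an element of $B(E)$, its adjoint $F_t^*$ is the bounded transform $F_{t^*}$ of $t^*$, it is a Fredholm operator, and $$\mathrm{Ker}\,t=\mathrm{Ker}\,F_t,\qquad \mathrm{Ker}\,t^*=\mathrm{Ker}\,F_{t^*}=\mathrm{Ker}\,F_t^*.$$ Each of these kernels has an orthonormal basis, all orthonormal bases of the same kernel have the same cardinality, and $\dim_{\mathcal{K}}\mathrm{Ker}\,t$ and $\dim_{\mathcal{K}}\mathrm{Ker}\,t^*$ are finite. Consequently the indices $$\mathrm{ind}\,t=\dim_{\mathcal{K}}\mathrm{Ker}\,t-\dim_{\mathcal{K}}\mathrm{Ker}\,t^*,\qquad \mathrm{ind}\,F_t=\dim_{\mathcal{K}}\mathrm{Ker}\,F_t-\dim_{\mathcal{K}}\mathrm{Ker}\,F_t^*$$ are well-defined integers, and $\mathrm{ind}\,t=\mathrm{ind}\,F_t$. -/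

import Mathlib

noncomputable section

namespace HilbertModule

/-! ### The C⋆-algebra of compact operators on a Hilbert space -/

section CompactOperators

variable (H : Type*) [NormedAddCommGroup H] [InnerProductSpace ℂ H] [CompleteSpace H]

/-- The Hilbert space adjoint of a compact operator is compact. -/
theorem isCompactOperator_star {H : Type*} [NormedAddCommGroup H] [InnerProductSpace ℂ H]
    [CompleteSpace H] {T : H →L[ℂ] H} (hT : IsCompactOperator T) :
    IsCompactOperator (star T : H →L[ℂ] H) := by
  have hS : IsCompactOperator (T ∘L star T) := hT.comp_clm (star T)
  have hSb : TotallyBounded ((T ∘L star T) '' Metric.closedBall 0 1) :=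
    ((hS.isCompact_closure_image_closedBall (f := ((T ∘L star T : H →L[ℂ] H) : H →ₗ[ℂ] H))
      1).totallyBounded).subset subset_closure
  have hb : TotallyBounded ((star T : H →L[ℂ] H) '' Metric.closedBall (0 : H) 1) := by
    rw [Metric.totallyBounded_iff]
    intro ε hε
    obtain ⟨t, ht, htf, hcov⟩ :=
      Metric.finite_approx_of_totallyBounded hSb (ε ^ 2 / 2) (by positivity)
    choose! g hg hg' using fun y (hy : y ∈ t) => ht hy
    refine ⟨(fun y => star T (g y)) '' t, htf.image _, ?_⟩
    rintro _ ⟨x, hx, rfl⟩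
    obtain ⟨y, hy, hxy⟩ := Set.mem_iUnion₂.1 (hcov ⟨x, hx, rfl⟩)
    refine Set.mem_iUnion₂.2 ⟨_, ⟨y, hy, rfl⟩, ?_⟩
    rw [Metric.mem_ball, dist_eq_norm, ← hg' y hy, ← map_sub] at hxy
    rw [Metric.mem_ball, dist_eq_norm, ← map_sub]
    set z := x - g y with hz
    have hz2 : ‖z‖ ≤ 2 := by
      have h1 : ‖x‖ ≤ 1 := by simpa using hx
      have h2 : ‖g y‖ ≤ 1 := by simpa using hg y hy
      calc ‖z‖ ≤ ‖x‖ + ‖g y‖ := norm_sub_le _ _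
        _ ≤ 2 := by linarith
    have key : ‖star T z‖ ^ 2 ≤ ‖(T ∘L star T) z‖ * ‖z‖ := by
      have h := norm_inner_le_norm (𝕜 := ℂ) ((T ∘L star T) z) z
      have h2 : inner ℂ ((T ∘L star T) z) z = inner ℂ (star T z) (star T z) := by
        rw [ContinuousLinearMap.star_eq_adjoint, ContinuousLinearMap.adjoint_inner_right]
        rfl
      rw [h2, inner_self_eq_norm_sq_to_K] at h
      simpa using h
    have : ‖star T z‖ ^ 2 < ε ^ 2 := by
      have h3 : ‖(T ∘L star T) z‖ * ‖z‖ ≤ ‖(T ∘L star T) z‖ * 2 := by gcongr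
      linarith
    exact lt_of_pow_lt_pow_left₀ 2 hε.le this
  have := (isCompactOperator_iff_isCompact_closure_image_closedBall
    ((star T : H →L[ℂ] H) : H →ₗ[ℂ] H) zero_lt_one).2
    (hb.closure.isCompact_of_isClosed isClosed_closure)
  exact this

/-- The compact operators on `H`, as a ⋆-subalgebra of the bounded operators. -/
def compactSubalgebra : NonUnitalStarSubalgebra ℂ (H →L[ℂ] H) where
  carrier := {T | IsCompactOperator T}
  add_mem' hS hT := hS.add hT
  zero_mem' := isCompactOperator_zero
  mul_mem' {_ T} hS _ := hS.comp_clm T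
  smul_mem' c _ hT := hT.smul c
  star_mem' hT := isCompactOperator_star hT

/-- `𝒦(H)`, the C⋆-algebra of all compact operators on the Hilbert space `H`, with the operator
norm, the Hilbert space adjoint as involution, and the order of a C⋆-algebra. -/
def CompactOp : Type _ := compactSubalgebra H

instance : NonUnitalCStarAlgebra (CompactOp H) :=
  NonUnitalStarSubalgebra.nonUnitalCStarAlgebra (compactSubalgebra H)
    (h_closed := isClosed_setOfPred_isCompactOperator)

instance : PartialOrder (CompactOp H) := CStarAlgebra.spectralOrder (CompactOp H)

instance : StarOrderedRing (CompactOp H) := CStarAlgebra.spectralOrderedRing (CompactOp H)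

end CompactOperators

/-! ### Operators on Hilbert C⋆-modules

Modules are left modules, and Mathlib's `inner A x y` is `A`-linear in `y`; the inner product
`⟨x, y⟩` that is `A`-linear in the first variable is thus `inner A y x`. -/

section Operators

variable (A : Type*) [NonUnitalCStarAlgebra A] [PartialOrder A] [StarOrderedRing A]
variable {E : Type*} [NormedAddCommGroup E] [NormedSpace ℂ E] [SMul A E] [CStarModule A E]

theorem inner_ext {A : Type*} [NonUnitalCStarAlgebra A] [PartialOrder A]
    {E : Type*} [NormedAddCommGroup E] [NormedSpace ℂ E] [SMul A E] [CStarModule A E] {x y : E} (h : ∀ z : E, inner A z x = inner A z y) : x = y := by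
  have h0 : inner A (x - y) (x - y) = 0 := by
    rw [CStarModule.inner_sub_right, h, sub_self]
  exact sub_eq_zero.1 (CStarModule.inner_self.1 h0)

theorem norm_act_le {A : Type*} [NonUnitalCStarAlgebra A] [PartialOrder A]
    {E : Type*} [NormedAddCommGroup E] [NormedSpace ℂ E] [SMul A E] [CStarModule A E] (a : A) (x : E) : ‖a • x‖ ≤ ‖a‖ * ‖x‖ := by
  have h : ‖a • x‖ ^ 2 ≤ (‖a‖ * ‖x‖) ^ 2 := by
    rw [mul_pow, CStarModule.norm_sq_eq A (x := a • x), CStarModule.norm_sq_eq A (x := x),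
      CStarModule.inner_op_smul_left, CStarModule.inner_op_smul_right]
    calc ‖a * inner A x x * star a‖ ≤ ‖a‖ * ‖inner A x x‖ * ‖star a‖ :=
          (norm_mul_le _ _).trans (by gcongr; exact norm_mul_le _ _)
      _ = ‖a‖ ^ 2 * ‖inner A x x‖ := by rw [norm_star]; ring
  exact le_of_sq_le_sq h (by positivity)

/-- The operator `Θ_{x,y}`, mapping `z` to `⟨z, x⟩ y`. -/
def theta (x y : E) : E →L[ℂ] E :=
  LinearMap.mkContinuous
    { toFun := fun z => inner A x z • y
      map_add' := fun z w => inner_ext (A := A) fun u => by simp [add_mul]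
      map_smul' := fun c z => inner_ext (A := A) fun u => by simp [smul_mul_assoc] }
    (‖x‖ * ‖y‖) fun z => by
      calc ‖inner A x z • y‖ ≤ ‖inner A x z‖ * ‖y‖ := norm_act_le _ _
        _ ≤ ‖x‖ * ‖z‖ * ‖y‖ := by gcongr; exact CStarModule.norm_inner_le E
        _ = ‖x‖ * ‖y‖ * ‖z‖ := by ring

variable (E) in
/-- `K(E)`, the `A`-compact operators: the norm closure of the span of the `Θ_{x,y}`. -/
def moduleCompacts : Submodule ℂ (E →L[ℂ] E) :=
  (Submodule.span ℂ {T : E →L[ℂ] E | ∃ x y : E, T = theta A x y}).topologicalClosure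

variable (E) in
/-- `B(E)`, the adjointable operators on `E`. An element is an operator together with its (unique)
adjoint. -/
@[ext]
structure Adjointable where
  op : E →L[ℂ] E
  adj : E →L[ℂ] E
  inner_op_left : ∀ x y : E, inner A (op x) y = inner A x (adj y)

variable {A}

/-- The adjoint `T⋆`, as an element of `B(E)`. -/
def Adjointable.conj (T : Adjointable A E) : Adjointable A E where
  op := T.adj
  adj := T.op
  inner_op_left x y := by
    rw [← CStarModule.star_inner y, ← T.inner_op_left, CStarModule.star_inner]

/-- An adjointable operator as an everywhere defined operator. -/
def Adjointable.toPMap (T : Adjointable A E) : E →ₗ.[ℂ] E :=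
  (T.op : E →ₗ[ℂ] E).toPMap ⊤

/-- A bounded operator `T` is Fredholm if it has left and right inverses modulo `K(E)`. -/
def Adjointable.IsFredholm (T : Adjointable A E) : Prop :=
  (∃ S : Adjointable A E, S.op ∘L T.op - ContinuousLinearMap.id ℂ E ∈ moduleCompacts A E) ∧
  ∃ S : Adjointable A E, T.op ∘L S.op - ContinuousLinearMap.id ℂ E ∈ moduleCompacts A E

/-- The composition `t s` with `Dom (t s) = {x ∈ Dom s | s x ∈ Dom t}`. -/
def pcomp (t s : E →ₗ.[ℂ] E) : E →ₗ.[ℂ] E :=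
  t.comp (s.domRestrict ((t.domain.comap s.toFun).map s.domain.subtype)) (by
    intro x
    obtain ⟨y, hy, hyx⟩ := Submodule.mem_map.1 x.2.1
    have h : s.domRestrict _ x = s y := LinearPMap.domRestrict_apply hyx.symm
    rw [h]
    exact hy)

/-- `Ker t = {x ∈ Dom t | t x = 0}`. -/
def pker (t : E →ₗ.[ℂ] E) : Submodule ℂ E :=
  (LinearMap.ker t.toFun).map t.domain.subtype

variable (A) in
/-- The pairs `(y, y')` with `⟨t x, y⟩ = ⟨x, y'⟩` for all `x ∈ Dom t`. -/
def adjointGraph (t : E →ₗ.[ℂ] E) : Submodule ℂ (E × E) where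
  carrier := {p | ∀ x : t.domain, inner A (t x) p.1 = inner A (x : E) p.2}
  add_mem' {p q} hp hq x := by simp [hp x, hq x]
  zero_mem' x := by simp
  smul_mem' c p hp x := by simp [hp x]

variable (A) in
/-- The adjoint `t⋆` of a densely defined operator `t`: its domain consists of all `y` for which
there is a `y'` with `⟨t x, y⟩ = ⟨x, y'⟩` for all `x ∈ Dom t`, and then `t⋆ y = y'`. -/
def padjoint (t : E →ₗ.[ℂ] E) : E →ₗ.[ℂ] E :=
  (adjointGraph A t).toLinearPMap

variable (A) in
/-- The operator `1 + t⋆ t`, with domain `Dom (t⋆ t)`. -/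
def oneAddAdjointMul (t : E →ₗ.[ℂ] E) : E →ₗ.[ℂ] E :=
  (LinearMap.id : E →ₗ[ℂ] E) +ᵥ pcomp (padjoint A t) t

variable (A) in
/-- Regular operators on a Hilbert `A`-module. -/
structure IsRegular (t : E →ₗ.[ℂ] E) : Prop where
  /-- `t` is `A`-linear, and its domain is a submodule -/
  smul_mem : ∀ (a : A) (x y : E), (x, y) ∈ t.graph → (a • x, a • y) ∈ t.graph
  isClosed : t.IsClosed
  dense_domain : Dense (t.domain : Set E)
  dense_adjoint_domain : Dense ((padjoint A t).domain : Set E)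
  dense_range : Dense (LinearMap.range (oneAddAdjointMul A t).toFun : Set E)

/-- `G` is a pseudo left inverse of `t`. -/
def IsPseudoLeftInverse (G : Adjointable A E) (t : E →ₗ.[ℂ] E) : Prop :=
  (pcomp G.toPMap t).IsClosable ∧ ∃ S : Adjointable A E,
    (pcomp G.toPMap t).closure = S.toPMap ∧
      S.op - ContinuousLinearMap.id ℂ E ∈ moduleCompacts A E

/-- `G` is a pseudo right inverse of `t`. -/
def IsPseudoRightInverse (G : Adjointable A E) (t : E →ₗ.[ℂ] E) : Prop :=
  (pcomp t G.toPMap).IsClosable ∧ ∃ S : Adjointable A E,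
    (pcomp t G.toPMap).closure = S.toPMap ∧
      S.op - ContinuousLinearMap.id ℂ E ∈ moduleCompacts A E

variable (A) in
/-- A regular operator is Fredholm if it has a pseudo left and a pseudo right inverse. -/
def IsFredholm (t : E →ₗ.[ℂ] E) : Prop :=
  (∃ G : Adjointable A E, IsPseudoLeftInverse G t) ∧
    ∃ G : Adjointable A E, IsPseudoRightInverse G t

/-- `Q = (1 + t⋆ t)^{-1/2}`: `Q` is positive and its square is the inverse of `1 + t⋆ t`. -/
def IsInvSqrt (t : E →ₗ.[ℂ] E) (Q : Adjointable A E) : Prop :=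
  (∀ x : E, 0 ≤ inner A x (Q.op x)) ∧
    pcomp Q.toPMap Q.toPMap = (oneAddAdjointMul A t).inverse

/-- `F` is the bounded transform `F_t = t (1 + t⋆ t)^{-1/2}` of `t`. -/
def IsBoundedTransform (t : E →ₗ.[ℂ] E) (F : Adjointable A E) : Prop :=
  ∃ Q : Adjointable A E, IsInvSqrt t Q ∧ F.toPMap = pcomp t Q.toPMap

/-! ### Orthonormal dimension and index -/

/-- A minimal projection: a nonzero projection `p` with `p A p = ℂ p`. -/
def IsMinimalProjection (p : A) : Prop :=
  IsStarProjection p ∧ p ≠ 0 ∧ ∀ a : A, ∃ c : ℂ, p * a * p = c • p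

variable (A) in
/-- `B` is an orthonormal basis of the closed submodule `X` of `E`: the elements `x` of `B` are
basic vectors (`⟨x, x⟩` is a minimal projection), distinct elements are orthogonal, and the
`A`-submodule generated by `B` is dense in `X`. -/
structure IsOrthonormalBasis (X : Submodule ℂ E) (B : Set E) : Prop where
  basic : ∀ x ∈ B, IsMinimalProjection (inner A x x)
  orthogonal : ∀ x ∈ B, ∀ y ∈ B, x ≠ y → inner A x y = 0
  dense_span : (Submodule.span ℂ (B ∪ {z | ∃ (a : A), ∃ x ∈ B, z = a • x})).topologicalClosure = X

variable (A) in
/-- `X` has an orthonormal basis, and all its orthonormal bases have cardinality `c`. -/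
def HasOrthonormalDim (X : Submodule ℂ E) (c : Cardinal) : Prop :=
  (∃ B : Set E, IsOrthonormalBasis A X B) ∧
    ∀ B : Set E, IsOrthonormalBasis A X B → Cardinal.mk B = c

variable (A) in
/-- The orthonormal dimension: the cardinality of any orthonormal basis (for definiteness, the
smallest one). -/
def orthonormalDim (X : Submodule ℂ E) : Cardinal :=
  sInf {c | ∃ B : Set E, IsOrthonormalBasis A X B ∧ Cardinal.mk B = c}

variable (A) in
/-- `ind t = dim Ker t - dim Ker t⋆`, meaningful if both dimensions are finite. -/
def index (t : E →ₗ.[ℂ] E) : ℤ :=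
  (Cardinal.toNat (orthonormalDim A (pker t)) : ℤ) -
    Cardinal.toNat (orthonormalDim A (pker (padjoint A t)))

/-- `ind T = dim Ker T - dim Ker T⋆` for a bounded operator `T`, meaningful if both dimensions are
finite. -/
def Adjointable.index (T : Adjointable A E) : ℤ :=
  (Cardinal.toNat (orthonormalDim A (LinearMap.ker (T.op : E →ₗ[ℂ] E))) : ℤ) -
    Cardinal.toNat (orthonormalDim A (LinearMap.ker (T.conj.op : E →ₗ[ℂ] E)))

end Operators

end HilbertModule

end

/-!
A regular operator `t` is parametrised by its bounded transform: with `Q = (1 + t⋆ t)^{-1/2}` and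
`F = t Q`, the column `(Q, F)` is an isometry of `E` into `E × E` whose range is the graph of `t`.
Regularity makes `R = (1 + t⋆ t)⁻¹` and `S = t R` bounded and everywhere defined; `R` is symmetric,
and `S` is adjointable because its formal adjoint `R t⋆` is densely defined. The root `Q` of `R` has
dense range and `S⋆ S = R - R² ≤ Q²`, so that `S = F Q` defines `F`. The column of `t⋆` is
`(Q', F⋆)` with `Q' = 1 - F (1 + Q)⁻¹ F⋆`.

Since `Q² + F⋆ F = 1` and `Q ≥ 0`, the equation `F y = 0` forces `Q y = y`; hence `ker t = ker F`.
A left pseudo-inverse `G` of `t` gives the left inverse `F⋆ + Q G` of `F` modulo compacts, for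
`(F⋆ + Q G) F - 1 = Q (\overline{G t} - 1) Q`, and a right pseudo-inverse `G` of `t` gives the right
inverse `Q G + F⋆ \overline{t G}`, for `F (Q G + F⋆ \overline{t G}) = \overline{t G}`.

For the dimension, let `e` be the projection onto a unit vector. The corner `e X` of a closed
submodule `X` is a Hilbert space, and Hilbert bases of `e X` are orthonormal bases of `X`;
conversely, moving each vector of an orthonormal basis of `X` into `e X` by a partial isometry of
rank one yields a Hilbert basis of `e X`. If some element of `K(E)` acts as the identity on `X`, as
happens for the kernel of a Fredholm operator, then the identity of `e X` is a compact operator and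
`e X` is finite-dimensional.
-/

noncomputable section

namespace HilbertModule

section AdjointableAlgebra

variable {A : Type*} [NonUnitalCStarAlgebra A] [PartialOrder A]
variable {E : Type*} [NormedAddCommGroup E] [NormedSpace ℂ E] [SMul A E] [CStarModule A E]

theorem inner_ext_left {x y : E} (h : ∀ z : E, inner A x z = inner A y z) : x = y :=
  inner_ext (A := A) fun z => by rw [← CStarModule.star_inner, h, CStarModule.star_inner]

namespace Adjointable

theorem inner_op_right (T : Adjointable A E) (x y : E) :
    inner A x (T.op y) = inner A (T.adj x) y :=
  (T.conj.inner_op_left x y).symm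

theorem op_act (T : Adjointable A E) (a : A) (x : E) : T.op (a • x) = a • T.op x :=
  inner_ext (A := A) fun z => by simp [T.inner_op_right]

theorem op_injective : Function.Injective (op : Adjointable A E → E →L[ℂ] E) := fun T S h =>
  Adjointable.ext h <| ContinuousLinearMap.ext fun y => inner_ext (A := A) fun x => by
    rw [← T.inner_op_left, h, S.inner_op_left]

instance : Zero (Adjointable A E) := ⟨0, 0, fun x y => by simp⟩

instance : One (Adjointable A E) := ⟨1, 1, fun _ _ => rfl⟩

instance : Add (Adjointable A E) :=
  ⟨fun T S => ⟨T.op + S.op, T.adj + S.adj, fun x y => by simp [inner_op_left]⟩⟩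

instance : Neg (Adjointable A E) :=
  ⟨fun T => ⟨-T.op, -T.adj, fun x y => by simp [inner_op_left]⟩⟩

instance : Sub (Adjointable A E) :=
  ⟨fun T S => ⟨T.op - S.op, T.adj - S.adj, fun x y => by simp [inner_op_left]⟩⟩

instance : Mul (Adjointable A E) :=
  ⟨fun T S => ⟨T.op * S.op, S.adj * T.adj, fun x y => by simp [inner_op_left]⟩⟩

instance : SMul ℂ (Adjointable A E) :=
  ⟨fun c T => ⟨c • T.op, star c • T.adj, fun x y => by simp [inner_op_left]⟩⟩

instance : Star (Adjointable A E) := ⟨conj⟩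

@[simp] theorem op_add (T S : Adjointable A E) : (T + S).op = T.op + S.op := rfl

@[simp] theorem op_neg (T : Adjointable A E) : (-T).op = -T.op := rfl

@[simp] theorem op_sub (T S : Adjointable A E) : (T - S).op = T.op - S.op := rfl

@[simp] theorem op_mul (T S : Adjointable A E) : (T * S).op = T.op * S.op := rfl

@[simp] theorem op_smul (c : ℂ) (T : Adjointable A E) : (c • T).op = c • T.op := rfl

@[simp] theorem op_star (T : Adjointable A E) : (star T).op = T.adj := rfl

instance : Ring (Adjointable A E) where
  add_assoc T S R := op_injective (add_assoc T.op S.op R.op)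
  zero_add T := op_injective (zero_add T.op)
  add_zero T := op_injective (add_zero T.op)
  add_comm T S := op_injective (add_comm T.op S.op)
  neg_add_cancel T := op_injective (neg_add_cancel T.op)
  sub_eq_add_neg T S := op_injective (sub_eq_add_neg T.op S.op)
  mul_assoc T S R := op_injective (mul_assoc T.op S.op R.op)
  one_mul T := op_injective (one_mul T.op)
  mul_one T := op_injective (mul_one T.op)
  zero_mul T := op_injective (zero_mul T.op)
  mul_zero T := op_injective (mul_zero T.op)
  left_distrib T S R := op_injective (mul_add T.op S.op R.op)
  right_distrib T S R := op_injective (add_mul T.op S.op R.op)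
  nsmul := nsmulRec
  zsmul := zsmulRec

instance : Module ℂ (Adjointable A E) where
  one_smul T := op_injective (one_smul ℂ T.op)
  mul_smul c d T := op_injective (mul_smul c d T.op)
  smul_zero c := op_injective (smul_zero c)
  smul_add c T S := op_injective (smul_add c T.op S.op)
  add_smul c d T := op_injective (add_smul c d T.op)
  zero_smul T := op_injective (zero_smul ℂ T.op)

instance : Algebra ℂ (Adjointable A E) :=
  Algebra.ofModule (fun c T S => op_injective (smul_mul_assoc c T.op S.op))
    (fun c T S => op_injective (mul_smul_comm c T.op S.op))

variable (A E) in
/-- The inclusion of the adjointable operators into the bounded operators. -/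
def opHom : Adjointable A E →ₐ[ℂ] (E →L[ℂ] E) :=
  AlgHom.ofLinearMap { toFun := op, map_add' := op_add, map_smul' := op_smul }
    rfl fun _ _ => rfl

instance : NormedRing (Adjointable A E) :=
  NormedRing.induced _ _ (opHom A E) op_injective

instance : NormedAlgebra ℂ (Adjointable A E) :=
  NormedAlgebra.induced ℂ _ _ (opHom A E)

theorem norm_op (T : Adjointable A E) : ‖T.op‖ = ‖T‖ := rfl

instance : StarRing (Adjointable A E) where
  star_involutive _ := rfl
  star_mul _ _ := rfl
  star_add _ _ := rfl

instance : StarModule ℂ (Adjointable A E) := ⟨fun _ _ => op_injective rfl⟩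

theorem inner_op_star (T : Adjointable A E) (x y : E) :
    inner A (T.op x) y = inner A x ((star T).op y) :=
  T.inner_op_left x y

variable [StarOrderedRing A]

instance : CStarRing (Adjointable A E) where
  norm_mul_self_le T := by
    rw [← sq, ← Real.le_sqrt (norm_nonneg _) (norm_nonneg _)]
    refine T.op.opNorm_le_bound (Real.sqrt_nonneg _) fun x => le_of_sq_le_sq ?_ (by positivity)
    rw [mul_pow, Real.sq_sqrt (norm_nonneg _), CStarModule.norm_sq_eq A, T.inner_op_star]
    calc ‖inner A x ((star T * T).op x)‖
        ≤ ‖x‖ * ‖(star T * T).op x‖ := CStarModule.norm_inner_le E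
      _ ≤ ‖x‖ * (‖star T * T‖ * ‖x‖) := by gcongr; exact (star T * T).op.le_opNorm x
      _ = ‖star T * T‖ * ‖x‖ ^ 2 := by ring

theorem isClosed_range_op_adj :
    IsClosed (Set.range fun T : Adjointable A E => (T.op, T.adj)) := by
  have range_eq : (Set.range fun T : Adjointable A E => (T.op, T.adj)) =
      ⋂ (x : E) (y : E), {p | inner A (p.1 x) y = inner A x (p.2 y)} := by
    ext p
    simp only [Set.mem_range, Set.mem_iInter, Set.mem_ofPred_eq]
    exact ⟨by rintro ⟨T, rfl⟩; exact T.inner_op_left, fun h => ⟨⟨p.1, p.2, h⟩, rfl⟩⟩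
  rw [range_eq]
  refine isClosed_iInter fun x => isClosed_iInter fun y => isClosed_eq ?_ ?_
  · exact CStarModule.continuous_inner.comp
      (by fun_prop : Continuous fun p : (E →L[ℂ] E) × (E →L[ℂ] E) => (p.1 x, y))
  · exact CStarModule.continuous_inner.comp
      (by fun_prop : Continuous fun p : (E →L[ℂ] E) × (E →L[ℂ] E) => (x, p.2 y))

variable [CompleteSpace E]

instance : CompleteSpace (Adjointable A E) := by
  have isometry_op_adj : Isometry fun T : Adjointable A E => (T.op, T.adj) :=
    Isometry.of_dist_eq fun T S => by
      rw [Prod.dist_eq, dist_eq_norm, dist_eq_norm, dist_eq_norm, ← op_sub, ← op_star,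
        ← op_star, ← op_sub, ← star_sub, norm_op, norm_op, norm_star, max_self]
  exact (completeSpace_iff_isComplete_range isometry_op_adj.isUniformInducing).2
    isClosed_range_op_adj.isComplete

instance : CStarAlgebra (Adjointable A E) where

instance : PartialOrder (Adjointable A E) := CStarAlgebra.spectralOrder _

instance : StarOrderedRing (Adjointable A E) := CStarAlgebra.spectralOrderedRing _

end Adjointable

end AdjointableAlgebra

section Positivity

variable {A : Type*} [NonUnitalCStarAlgebra A] [PartialOrder A]
variable {E : Type*} [NormedAddCommGroup E] [NormedSpace ℂ E] [SMul A E] [CStarModule A E]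

theorem eq_zero_of_inner_self_eq_zero {T : E →L[ℂ] E} (h : ∀ x, inner A x (T x) = 0) : T = 0 := by
  refine ContinuousLinearMap.ext fun y => inner_ext (A := A) fun x => ?_
  -- Polarisation: `⟨x, T y⟩ = -⟨y, T x⟩`, and the same with `i y` in place of `y`.
  have h_add := h (x + y)
  have h_add_I := h (x + Complex.I • y)
  simp only [map_add, map_smul, CStarModule.inner_add_left, CStarModule.inner_add_right,
    CStarModule.inner_smul_left_complex, CStarModule.inner_smul_right_complex, h, smul_zero,
    add_zero, zero_add] at h_add h_add_I
  rw [eq_neg_of_add_eq_zero_left h_add] at h_add_I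
  have two_I_smul : (2 * Complex.I) • inner A x (T y) = 0 := by
    rw [← h_add_I]; simp [two_mul, add_smul]
  simpa using two_I_smul

namespace Adjointable

variable [StarOrderedRing A]

theorem isSelfAdjoint_of_inner_nonneg {T : Adjointable A E}
    (h : ∀ x, 0 ≤ inner A x (T.op x)) : IsSelfAdjoint T := by
  refine sub_eq_zero.1 (op_injective (eq_zero_of_inner_self_eq_zero (A := A) fun x => ?_))
  have inner_star : inner A x ((star T).op x) = inner A x (T.op x) := by
    rw [← T.inner_op_star, ← CStarModule.star_inner, (IsSelfAdjoint.of_nonneg (h x)).star_eq]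
  rw [op_sub, sub_apply, CStarModule.inner_sub_right, inner_star, sub_self]

variable [CompleteSpace E]

theorem inner_nonneg_of_nonneg {T : Adjointable A E} (hT : 0 ≤ T) (x : E) :
    0 ≤ inner A x (T.op x) := by
  obtain ⟨S, rfl⟩ := CStarAlgebra.nonneg_iff_eq_star_mul_self.1 hT
  exact (CStarModule.inner_self_nonneg (x := S.op x)).trans_eq (S.inner_op_star x (S.op x))

theorem nonneg_iff_inner_nonneg {T : Adjointable A E} :
    0 ≤ T ↔ ∀ x : E, 0 ≤ inner A x (T.op x) := by
  refine ⟨inner_nonneg_of_nonneg, fun h => ?_⟩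
  have hT := isSelfAdjoint_of_inner_nonneg h
  have hN : 0 ≤ T⁻ := CFC.negPart_nonneg T
  have N_sa : star T⁻ = T⁻ := (IsSelfAdjoint.of_nonneg hN).star_eq
  have N_mul_T_mul_N : T⁻ * T * T⁻ = -(T⁻ * T⁻ * T⁻) := by
    nth_rw 2 [← CFC.posPart_sub_negPart T hT]
    rw [mul_sub, CFC.negPart_mul_posPart, zero_sub, neg_mul]
  have N_cube_nonneg : 0 ≤ T⁻ * T⁻ * T⁻ := by
    simpa only [N_sa] using star_left_conjugate_nonneg hN T⁻
  have N_cube : T⁻ * T⁻ * T⁻ = 0 := by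
    refine op_injective (eq_zero_of_inner_self_eq_zero (A := A) fun x =>
      le_antisymm ?_ (inner_nonneg_of_nonneg N_cube_nonneg x))
    have h_Nx : 0 ≤ inner A x ((T⁻ * T * T⁻).op x) := by
      simpa only [inner_op_star, N_sa, op_mul, mul_apply_eq_comp] using h (T⁻.op x)
    simpa only [N_mul_T_mul_N, op_neg, neg_apply, CStarModule.inner_neg_right,
      Left.nonneg_neg_iff] using h_Nx
  have N_sq : T⁻ * T⁻ = 0 := by
    rw [← CStarRing.star_mul_self_eq_zero_iff, star_mul, N_sa, ← mul_assoc, N_cube, zero_mul]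
  have N_eq_zero : T⁻ = 0 := by rwa [← CStarRing.star_mul_self_eq_zero_iff, N_sa]
  exact (CFC.negPart_eq_zero_iff T hT).1 N_eq_zero

end Adjointable

end Positivity

section Rotation

variable {B : Type*} [CStarAlgebra B] [PartialOrder B] [StarOrderedRing B]

theorem exists_nonneg_intertwiner {q f : B} (hq : 0 ≤ q) (h : q * q + star f * f = 1) :
    ∃ q' : B, 0 ≤ q' ∧ q' * q' + f * star f = 1 ∧ f * q = q' * f := by
  obtain ⟨u, hu⟩ : IsUnit (1 + q) := CStarAlgebra.isUnit_of_le 1 (le_add_of_nonneg_right hq)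
  set m : B := ↑u⁻¹
  have add_mul_m : (1 + q) * m = 1 := by rw [← hu, Units.mul_inv]
  have m_mul_add : m * (1 + q) = 1 := by rw [← hu, Units.inv_mul]
  have m_mul : m * (star f * f) = 1 - q := by
    rw [← add_sub_cancel_left (q * q) (star f * f), h]
    calc m * (1 - q * q) = m * (1 + q) * (1 - q) := by noncomm_ring
      _ = 1 - q := by rw [m_mul_add, one_mul]
  have m_le : m ≤ 1 := CStarAlgebra.inv_le_one <|
    Units.val_le_val.1 (by rw [hu]; exact le_add_of_nonneg_right hq)
  have m_sa : star m = m :=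
    (IsSelfAdjoint.of_nonneg (CFC.inv_nonneg_of_nonneg u (hu ▸ add_nonneg zero_le_one hq))).star_eq
  -- Formally `1 - f (1 + q)⁻¹ f⋆` is `(1 - f f⋆)^{1/2}`, because `f⋆ f = (1 - q) (1 + q)`.
  set q' := 1 - f * m * star f with q'_def
  have intertwine : q' * f = f * q :=
    calc q' * f = f - f * (m * (star f * f)) := by simp only [q'_def]; noncomm_ring
      _ = f * q := by rw [m_mul]; noncomm_ring
  have sq : q' * q' + f * star f = 1 :=
    calc q' * q' + f * star f = q' - q' * f * m * star f + f * star f := by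
          nth_rw 2 [q'_def]; noncomm_ring
      _ = 1 - f * ((1 + q) * m) * star f + f * star f := by
          rw [intertwine, q'_def]; noncomm_ring
      _ = 1 := by rw [add_mul_m]; noncomm_ring
  have q'_sa : star q' = q' := by
    simp [q'_def, m_sa, mul_assoc]
  have q'_eq : q' = star q' * q' + f * (1 - m) * star f := by
    rw [q'_sa, eq_sub_of_add_eq sq, q'_def]; noncomm_ring
  refine ⟨q', ?_, sq, intertwine.symm⟩
  rw [q'_eq]
  exact add_nonneg (star_mul_self_nonneg q')
    (star_right_conjugate_nonneg (sub_nonneg.2 m_le) f)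

end Rotation

section Graphs

variable {A : Type*} [NonUnitalCStarAlgebra A] [PartialOrder A]
variable {E : Type*} [NormedAddCommGroup E] [NormedSpace ℂ E] [SMul A E] [CStarModule A E]

theorem mem_graph_toPMap {T : Adjointable A E} {x y : E} :
    (x, y) ∈ T.toPMap.graph ↔ y = T.op x := by
  rw [LinearPMap.mem_graph_iff]
  constructor
  · rintro ⟨z, rfl : (z : E) = x, rfl : T.op z = y⟩
    rfl
  · rintro rfl
    exact ⟨⟨x, trivial⟩, rfl, rfl⟩

theorem mem_graph_pcomp {t s : E →ₗ.[ℂ] E} {x z : E} :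
    (x, z) ∈ (pcomp t s).graph ↔ ∃ y, (x, y) ∈ s.graph ∧ (y, z) ∈ t.graph := by
  have graph_of_domain : ∀ (w : (pcomp t s).domain) (hw : (w : E) ∈ s.domain),
      (s ⟨w, hw⟩, pcomp t s w) ∈ t.graph := by
    intro w hw
    have restrict_apply :
        s.domRestrict ((t.domain.comap s.toFun).map s.domain.subtype) w = s ⟨w, hw⟩ :=
      LinearPMap.domRestrict_apply rfl
    obtain ⟨y, hy, hyw⟩ := Submodule.mem_map.1 w.2.1
    obtain rfl : y = ⟨w, hw⟩ := Subtype.ext hyw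
    exact (LinearPMap.mem_graph_iff _).2
      ⟨⟨s.domRestrict _ w, by rw [restrict_apply]; exact hy⟩, restrict_apply, rfl⟩
  constructor
  · intro h
    obtain ⟨w, rfl : (w : E) = x, rfl : pcomp t s w = z⟩ := (LinearPMap.mem_graph_iff _).1 h
    exact ⟨s ⟨w, w.2.2⟩, s.mem_graph ⟨w, w.2.2⟩, graph_of_domain w w.2.2⟩
  · rintro ⟨y, hxy, hyz⟩
    obtain ⟨w, rfl : (w : E) = x, rfl : s w = y⟩ := (LinearPMap.mem_graph_iff _).1 hxy
    have hw : (w : E) ∈ (pcomp t s).domain :=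
      ⟨Submodule.mem_map.2 ⟨w, LinearPMap.mem_domain_of_mem_graph hyz, rfl⟩, w.2⟩
    rw [← t.mem_graph_snd_inj (graph_of_domain ⟨w, hw⟩ w.2) hyz rfl]
    exact (pcomp t s).mem_graph ⟨w, hw⟩

theorem mem_pker {t : E →ₗ.[ℂ] E} {x : E} : x ∈ pker t ↔ (x, 0) ∈ t.graph := by
  rw [pker, Submodule.mem_map, LinearPMap.mem_graph_iff]
  exact ⟨fun ⟨y, hy, h⟩ => ⟨y, h, hy⟩, fun ⟨y, h, hy⟩ => ⟨y, hy, h⟩⟩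

theorem mem_graph_oneAddAdjointMul {t : E →ₗ.[ℂ] E} {x w : E} :
    (x, w) ∈ (oneAddAdjointMul A t).graph ↔
      ∃ u, (x, u) ∈ t.graph ∧ (u, w - x) ∈ (padjoint A t).graph := by
  have apply_eq : ∀ y, oneAddAdjointMul A t y = (y : E) + pcomp (padjoint A t) t y := fun _ => rfl
  rw [← mem_graph_pcomp, LinearPMap.mem_graph_iff, LinearPMap.mem_graph_iff]
  refine exists_congr fun y => and_congr_right ?_
  rintro (rfl : (y : E) = x)
  exact (apply_eq y ▸ eq_sub_iff_add_eq'.symm)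

theorem mem_adjointGraph {t : E →ₗ.[ℂ] E} {z z' : E} :
    (z, z') ∈ adjointGraph A t ↔
      ∀ x u : E, (x, u) ∈ t.graph → inner A u z = inner A x z' := by
  refine ⟨fun h x u hxu => ?_, fun h x => h x (t x) (t.mem_graph x)⟩
  obtain ⟨y, rfl : (y : E) = x, rfl : t y = u⟩ := (LinearPMap.mem_graph_iff _).1 hxu
  exact h y

theorem Adjointable.toPMap_injective :
    Function.Injective (toPMap : Adjointable A E → E →ₗ.[ℂ] E) := fun T S h =>
  op_injective <| ContinuousLinearMap.ext fun x =>
    mem_graph_toPMap.1 (h ▸ mem_graph_toPMap.2 rfl : (x, T.op x) ∈ S.toPMap.graph)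

theorem pcomp_toPMap (T S : Adjointable A E) : pcomp T.toPMap S.toPMap = (T * S).toPMap := by
  refine LinearPMap.eq_of_eq_graph (SetLike.ext ?_)
  rintro ⟨x, z⟩
  simp only [mem_graph_pcomp, mem_graph_toPMap, exists_eq_left, Adjointable.op_mul,
    mul_apply_eq_comp]

theorem isClosed_pcomp_toPMap {t : E →ₗ.[ℂ] E} (ht : t.IsClosed) (G : Adjointable A E) :
    (pcomp t G.toPMap).IsClosed := by
  have graph_eq : ((pcomp t G.toPMap).graph : Set (E × E)) =
      (fun p : E × E => (G.op p.1, p.2)) ⁻¹' (t.graph : Set (E × E)) := by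
    ext ⟨x, z⟩
    simp only [SetLike.mem_coe, mem_graph_pcomp, mem_graph_toPMap, exists_eq_left,
      Set.mem_preimage]
  rw [LinearPMap.IsClosed, graph_eq]
  exact IsClosed.preimage (by fun_prop) ht

variable [StarOrderedRing A]

theorem continuous_inner_right (x : E) : Continuous fun y : E => inner A x y :=
  CStarModule.continuous_inner.comp (by fun_prop : Continuous fun y => (x, y))

theorem continuous_inner_left (y : E) : Continuous fun x : E => inner A x y :=
  CStarModule.continuous_inner.comp (by fun_prop : Continuous fun x => (x, y))

theorem inner_ext_of_dense {D : Set E} (hD : Dense D) {x y : E}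
    (h : ∀ z ∈ D, inner A z x = inner A z y) : x = y :=
  inner_ext (A := A) <| congrFun <|
    Continuous.ext_on hD (continuous_inner_left x) (continuous_inner_left y) h

theorem graph_padjoint {t : E →ₗ.[ℂ] E} (hd : Dense (t.domain : Set E)) :
    (padjoint A t).graph = adjointGraph A t := by
  refine Submodule.toLinearPMap_graph_eq _ ?_
  rintro ⟨z, z'⟩ h (rfl : z = 0)
  refine inner_ext_of_dense (A := A) hd fun x hx => ?_
  rw [← h ⟨x, hx⟩, CStarModule.inner_zero_right, CStarModule.inner_zero_right]

theorem isClosed_adjointGraph (t : E →ₗ.[ℂ] E) :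
    IsClosed (adjointGraph A t : Set (E × E)) := by
  have coe_eq_iInter : (adjointGraph A t : Set (E × E)) =
      ⋂ x : t.domain, {p : E × E | inner A (t x) p.1 = inner A (x : E) p.2} := by
    ext p; simp [adjointGraph]
  rw [coe_eq_iInter]
  exact isClosed_iInter fun x => isClosed_eq ((continuous_inner_right (t x)).comp continuous_fst)
    ((continuous_inner_right (x : E)).comp continuous_snd)

end Graphs

section TransformPair

variable {A : Type*} [NonUnitalCStarAlgebra A] [PartialOrder A] [StarOrderedRing A]
variable {E : Type*} [NormedAddCommGroup E] [NormedSpace ℂ E] [CompleteSpace E]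
  [SMul A E] [CStarModule A E]

/-- The pair `Q = (1 + t⋆ t)^{-1/2}`, `F = t (1 + t⋆ t)^{-1/2}`, characterised without reference to
`t⋆`: the column `(Q, F)` is an isometry of `E` into `E × E` with `Q ≥ 0` whose range is the graph
of `t`. -/
structure IsTransformPair (t : E →ₗ.[ℂ] E) (Q F : Adjointable A E) : Prop where
  nonneg : 0 ≤ Q
  mul_self_add : Q * Q + star F * F = 1
  mem_graph_iff : ∀ x u, (x, u) ∈ t.graph ↔ ∃ y, x = Q.op y ∧ u = F.op y

namespace IsTransformPair

variable {t : E →ₗ.[ℂ] E} {Q F : Adjointable A E}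

theorem op_op_add (h : IsTransformPair t Q F) (x : E) :
    Q.op (Q.op x) + F.adj (F.op x) = x :=
  congrArg (fun T : Adjointable A E => T.op x) h.mul_self_add

theorem inner_op_left (h : IsTransformPair t Q F) (x y : E) :
    inner A (Q.op x) y = inner A x (Q.op y) := by
  rw [Q.inner_op_left, ← Q.op_star, (IsSelfAdjoint.of_nonneg h.nonneg).star_eq]

theorem mem_adjointGraph_iff (h : IsTransformPair t Q F) {z z' : E} :
    (z, z') ∈ adjointGraph A t ↔ F.adj z = Q.op z' := by
  rw [mem_adjointGraph]
  constructor
  · refine fun hz => inner_ext (A := A) fun y => ?_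
    rw [← F.inner_op_left, ← h.inner_op_left]
    exact hz _ _ ((h.mem_graph_iff _ _).2 ⟨y, rfl, rfl⟩)
  · rintro hz x u hxu
    obtain ⟨y, rfl, rfl⟩ := (h.mem_graph_iff x u).1 hxu
    rw [F.inner_op_left, h.inner_op_left, hz]

theorem mem_graph_padjoint_iff (h : IsTransformPair t Q F) (hd : Dense (t.domain : Set E))
    {z z' : E} : (z, z') ∈ (HilbertModule.padjoint A t).graph ↔ F.adj z = Q.op z' := by
  rw [graph_padjoint hd, h.mem_adjointGraph_iff]

theorem mem_graph_oneAddAdjointMul_iff (h : IsTransformPair t Q F)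
    (hd : Dense (t.domain : Set E)) {x w : E} :
    (x, w) ∈ (oneAddAdjointMul A t).graph ↔ x = (Q * Q).op w := by
  rw [mem_graph_oneAddAdjointMul]
  constructor
  · rintro ⟨u, hxu, huw⟩
    obtain ⟨y, rfl, rfl⟩ := (h.mem_graph_iff x u).1 hxu
    have y_eq : y = Q.op w := by
      conv_lhs => rw [← h.op_op_add y, (h.mem_graph_padjoint_iff hd).1 huw]
      rw [← map_add, add_sub_cancel]
    exact congrArg Q.op y_eq
  · rintro rfl
    refine ⟨F.op (Q.op w), (h.mem_graph_iff _ _).2 ⟨Q.op w, rfl, rfl⟩,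
      (h.mem_graph_padjoint_iff hd).2 ?_⟩
    rw [map_sub, eq_sub_iff_add_eq']
    exact h.op_op_add (Q.op w)

theorem inverse_oneAddAdjointMul (h : IsTransformPair t Q F) (hd : Dense (t.domain : Set E)) :
    (oneAddAdjointMul A t).inverse = (Q * Q).toPMap := by
  have ker_eq_bot : LinearMap.ker (oneAddAdjointMul A t).toFun = ⊥ := by
    refine LinearMap.ker_eq_bot'.2 fun y hy => Subtype.ext ?_
    have mem_graph : ((y : E), (0 : E)) ∈ (oneAddAdjointMul A t).graph :=
      hy ▸ LinearPMap.mem_graph _ y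
    simpa using (h.mem_graph_oneAddAdjointMul_iff hd).1 mem_graph
  refine LinearPMap.eq_of_eq_graph (SetLike.ext ?_)
  rintro ⟨w, x⟩
  rw [LinearPMap.inverse_graph ker_eq_bot, mem_graph_toPMap, ← h.mem_graph_oneAddAdjointMul_iff hd]
  simp

theorem isInvSqrt_iff (h : IsTransformPair t Q F) (hd : Dense (t.domain : Set E))
    {P : Adjointable A E} : IsInvSqrt t P ↔ P = Q := by
  rw [IsInvSqrt, ← Adjointable.nonneg_iff_inner_nonneg, h.inverse_oneAddAdjointMul hd,
    pcomp_toPMap, Adjointable.toPMap_injective.eq_iff]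
  exact ⟨fun ⟨hP, hPP⟩ => (CFC.mul_self_eq_mul_self_iff P Q hP h.nonneg).1 hPP,
    by rintro rfl; exact ⟨h.nonneg, rfl⟩⟩

theorem pcomp_toPMap_eq (h : IsTransformPair t Q F) : pcomp t Q.toPMap = F.toPMap := by
  refine LinearPMap.eq_of_eq_graph (SetLike.ext ?_)
  rintro ⟨x, z⟩
  simp only [mem_graph_pcomp, mem_graph_toPMap, exists_eq_left]
  have mem_graph : (Q.op x, F.op x) ∈ t.graph := (h.mem_graph_iff _ _).2 ⟨x, rfl, rfl⟩
  exact ⟨fun hz => t.mem_graph_snd_inj hz mem_graph rfl, fun hz => hz ▸ mem_graph⟩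

theorem isBoundedTransform_iff (h : IsTransformPair t Q F) (hd : Dense (t.domain : Set E))
    {P : Adjointable A E} : IsBoundedTransform t P ↔ P = F := by
  simp only [IsBoundedTransform, h.isInvSqrt_iff hd, exists_eq_left, h.pcomp_toPMap_eq,
    Adjointable.toPMap_injective.eq_iff]

theorem exists_padjoint (h : IsTransformPair t Q F) (hd : Dense (t.domain : Set E)) :
    ∃ Q', IsTransformPair (padjoint A t) Q' (star F) := by
  obtain ⟨Q', hQ', mul_self_add', intertwine⟩ := exists_nonneg_intertwiner h.nonneg h.mul_self_add
  refine ⟨Q', hQ', by rwa [star_star], fun z z' => ?_⟩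
  have op_op_add' : Q'.op (Q'.op z) + F.op (F.adj z) = z :=
    congrArg (fun T : Adjointable A E => T.op z) mul_self_add'
  have op_Q : ∀ y, F.op (Q.op y) = Q'.op (F.op y) :=
    fun y => congrArg (fun T : Adjointable A E => T.op y) intertwine
  have adj_Q' : ∀ y, F.adj (Q'.op y) = Q.op (F.adj y) := by
    have intertwine_star := congrArg star intertwine
    rw [star_mul, star_mul, (IsSelfAdjoint.of_nonneg hQ').star_eq,
      (IsSelfAdjoint.of_nonneg h.nonneg).star_eq] at intertwine_star
    exact fun y => (congrArg (fun T : Adjointable A E => T.op y) intertwine_star).symm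
  rw [h.mem_graph_padjoint_iff hd, Adjointable.op_star]
  constructor
  · intro hz
    refine ⟨Q'.op z + F.op z', ?_, ?_⟩
    · rw [map_add, ← op_Q, ← hz, op_op_add']
    · rw [map_add, adj_Q', hz, h.op_op_add]
  · rintro ⟨y, rfl, rfl⟩
    exact adj_Q' y

theorem op_eq_self (h : IsTransformPair t Q F) {y : E} (hy : F.op y = 0) : Q.op y = y := by
  set z := Q.op y - y with z_def
  have Q_z : Q.op z = -z := by
    have Q_Q_y : Q.op (Q.op y) = y := by simpa only [hy, map_zero, add_zero] using h.op_op_add y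
    rw [z_def, map_sub, Q_Q_y, neg_sub]
  have inner_z : inner A z z ≤ 0 := by
    simpa [Q_z] using Adjointable.inner_nonneg_of_nonneg h.nonneg z
  exact sub_eq_zero.1 <| CStarModule.inner_self.1 <|
    le_antisymm inner_z CStarModule.inner_self_nonneg

theorem pker_eq_ker (h : IsTransformPair t Q F) :
    pker t = LinearMap.ker (F.op : E →ₗ[ℂ] E) := by
  ext x
  rw [mem_pker, h.mem_graph_iff, LinearMap.mem_ker, ContinuousLinearMap.coe_coe]
  constructor
  · rintro ⟨y, rfl, hy⟩
    rw [h.op_eq_self hy.symm, ← hy]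
  · exact fun hx => ⟨x, (h.op_eq_self hx).symm, hx.symm⟩

end IsTransformPair

end TransformPair

theorem exists_clm_forall_mem_of_isClosed {𝕜 E F : Type*} [NontriviallyNormedField 𝕜]
    [NormedAddCommGroup E] [NormedSpace 𝕜 E] [NormedAddCommGroup F] [NormedSpace 𝕜 F]
    [CompleteSpace F] {G : Submodule 𝕜 (E × F)} (hG : IsClosed (G : Set (E × F)))
    (hd : Dense (Prod.fst '' (G : Set (E × F)))) {C : ℝ} (hC : ∀ p ∈ G, ‖p.2‖ ≤ C * ‖p.1‖) :
    ∃ T : E →L[𝕜] F, ∀ x, (x, T x) ∈ G := by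
  let e : G →ₗ[𝕜] E := LinearMap.fst 𝕜 E F ∘ₗ G.subtype
  let f : G →ₗ[𝕜] F := LinearMap.snd 𝕜 E F ∘ₗ G.subtype
  have he : DenseRange e := hd.mono <| by
    rintro _ ⟨p, hp, rfl⟩
    exact ⟨⟨p, hp⟩, rfl⟩
  refine ⟨f.extendOfNorm e, fun x => he.induction_on x ?_ fun p => ?_⟩
  · exact hG.preimage (continuous_id.prodMk (f.extendOfNorm e).continuous)
  · rw [LinearMap.extendOfNorm_eq he ⟨C, fun p => hC p p.2⟩]
    exact p.2

section Resolvent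

variable {A : Type*} [NonUnitalCStarAlgebra A] [PartialOrder A]
variable {E : Type*} [NormedAddCommGroup E] [NormedSpace ℂ E] [SMul A E] [CStarModule A E]

theorem inner_eq_add_of_mem_adjointGraph {t : E →ₗ.[ℂ] E} {x u y v w : E}
    (hxu : (x, u) ∈ t.graph) (hv : (v, w - y) ∈ adjointGraph A t) :
    inner A x w = inner A x y + inner A u v := by
  rw [mem_adjointGraph.1 hv x u hxu, ← CStarModule.inner_add_right, add_sub_cancel]

/-- `R = (1 + t⋆ t)⁻¹` and `S = t R`, written as `R w ∈ Dom t`, `S w = t (R w)` and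
`t⋆ (S w) = w - R w` for all `w`. -/
structure IsResolventPair (t : E →ₗ.[ℂ] E) (R S : Adjointable A E) : Prop where
  mem_graph : ∀ w, (R.op w, S.op w) ∈ t.graph
  mem_adjointGraph : ∀ w, (S.op w, w - R.op w) ∈ adjointGraph A t

theorem IsResolventPair.inner_eq {t : E →ₗ.[ℂ] E} {R S : Adjointable A E}
    (h : IsResolventPair t R S) {x u : E} (hxu : (x, u) ∈ t.graph) (w : E) :
    inner A x w = inner A x (R.op w) + inner A u (S.op w) :=
  inner_eq_add_of_mem_adjointGraph hxu (h.mem_adjointGraph w)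

variable [StarOrderedRing A]

theorem norm_le_norm_of_inner_le {x y : E} (h : inner A x x ≤ inner A y y) : ‖x‖ ≤ ‖y‖ := by
  refine le_of_sq_le_sq ?_ (norm_nonneg y)
  rw [CStarModule.norm_sq_eq A, CStarModule.norm_sq_eq A]
  exact CStarAlgebra.norm_le_norm_of_nonneg_of_le CStarModule.inner_self_nonneg h

theorem norm_le_of_mem_adjointGraph {t : E →ₗ.[ℂ] E} {x u w : E} (hxu : (x, u) ∈ t.graph)
    (hu : (u, w - x) ∈ adjointGraph A t) : ‖(x, u)‖ ≤ ‖w‖ := by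
  obtain ⟨v, rfl⟩ : ∃ v, w = x + v := ⟨w - x, (add_sub_cancel x w).symm⟩
  rw [add_sub_cancel_left] at hu
  have inner_x_v : inner A x v = inner A u u := (mem_adjointGraph.1 hu x u hxu).symm
  have inner_v_x : inner A v x = inner A u u := by
    rw [← CStarModule.star_inner, inner_x_v, CStarModule.star_inner]
  have inner_w : inner A (x + v) (x + v) =
      inner A x x + inner A u u + inner A u u + inner A v v := by
    simp only [CStarModule.inner_add_left, CStarModule.inner_add_right, inner_x_v, inner_v_x]
    abel
  have hx : 0 ≤ inner A x x := CStarModule.inner_self_nonneg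
  have hu : 0 ≤ inner A u u := CStarModule.inner_self_nonneg
  have hv : 0 ≤ inner A v v := CStarModule.inner_self_nonneg
  refine max_le (norm_le_norm_of_inner_le (A := A) ?_) (norm_le_norm_of_inner_le (A := A) ?_)
  · rw [inner_w, add_assoc, add_assoc]
    exact le_add_of_nonneg_right (by positivity)
  · rw [inner_w, add_right_comm]
    exact le_add_of_nonneg_left (by positivity)

variable [CompleteSpace E]

theorem exists_adjointable_of_dense (T : E →L[ℂ] E) {D : Set E} (hD : Dense D)
    (h : ∀ z ∈ D, ∃ w, ∀ y, inner A (T y) z = inner A y w) :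
    ∃ S : Adjointable A E, S.op = T := by
  let G : Submodule ℂ (E × E) := adjointGraph A ((T : E →ₗ[ℂ] E).toPMap ⊤)
  have mem_G : ∀ p : E × E, p ∈ G ↔ ∀ y, inner A (T y) p.1 = inner A y p.2 := fun p =>
    ⟨fun hp y => hp ⟨y, trivial⟩, fun hp y => hp y⟩
  have dense_fst : Dense (Prod.fst '' (G : Set (E × E))) := hD.mono fun z hz =>
    let ⟨w, hw⟩ := h z hz
    ⟨(z, w), (mem_G _).2 hw, rfl⟩
  have norm_snd_le : ∀ p ∈ G, ‖p.2‖ ≤ ‖T‖ * ‖p.1‖ := by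
    intro p hp
    rcases (norm_nonneg p.2).eq_or_lt with norm_eq | norm_pos
    · rw [← norm_eq]; positivity
    refine le_of_mul_le_mul_right ?_ norm_pos
    calc ‖p.2‖ * ‖p.2‖ = ‖inner A (T p.2) p.1‖ := by
          rw [(mem_G p).1 hp, ← sq, CStarModule.norm_sq_eq A]
      _ ≤ ‖T p.2‖ * ‖p.1‖ := CStarModule.norm_inner_le E
      _ ≤ ‖T‖ * ‖p.2‖ * ‖p.1‖ := by gcongr; exact T.le_opNorm _
      _ = ‖T‖ * ‖p.1‖ * ‖p.2‖ := by ring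
  obtain ⟨S, hS⟩ :=
    exists_clm_forall_mem_of_isClosed (isClosed_adjointGraph _) dense_fst norm_snd_le
  exact ⟨⟨T, S, fun x y => (mem_G _).1 (hS y) x⟩, rfl⟩

variable {t : E →ₗ.[ℂ] E}

theorem exists_adjointable_of_mem_graph (hd : Dense (t.domain : Set E))
    (hd' : Dense ((padjoint A t).domain : Set E)) (P : Adjointable A E) {T : E →L[ℂ] E}
    (hT : ∀ y, (P.op y, T y) ∈ t.graph) : ∃ S : Adjointable A E, S.op = T := by
  refine exists_adjointable_of_dense T hd' fun z hz => ?_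
  obtain ⟨z', hzz'⟩ := LinearPMap.mem_domain_iff.1 hz
  rw [graph_padjoint hd] at hzz'
  exact ⟨P.adj z', fun y => by rw [mem_adjointGraph.1 hzz' _ _ (hT y), P.inner_op_left]⟩

theorem IsRegular.exists_isResolventPair (ht : IsRegular A t) :
    ∃ R S : Adjointable A E, IsResolventPair t R S := by
  let G : Submodule ℂ (E × (E × E)) := (t.graph.comap (LinearMap.snd ℂ E (E × E))) ⊓
    (adjointGraph A t).comap ((LinearMap.snd ℂ E E ∘ₗ LinearMap.snd ℂ E (E × E)).prod
      (LinearMap.fst ℂ E (E × E) - LinearMap.fst ℂ E E ∘ₗ LinearMap.snd ℂ E (E × E)))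
  have isClosed_G : IsClosed (G : Set (E × (E × E))) :=
    (IsClosed.preimage continuous_snd ht.isClosed).inter
      (IsClosed.preimage (f := fun p : E × (E × E) => (p.2.2, p.1 - p.2.1)) (by fun_prop)
        (isClosed_adjointGraph (A := A) t))
  have dense_fst : Dense (Prod.fst '' (G : Set (E × (E × E)))) := by
    refine ht.dense_range.mono ?_
    rintro _ ⟨x, rfl⟩
    obtain ⟨u, hxu, hu⟩ :=
      mem_graph_oneAddAdjointMul.1 (LinearPMap.mem_graph (oneAddAdjointMul A t) x)
    rw [graph_padjoint ht.dense_domain] at hu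
    exact ⟨(_, ((x : E), u)), ⟨hxu, hu⟩, rfl⟩
  obtain ⟨T, hT⟩ := exists_clm_forall_mem_of_isClosed isClosed_G dense_fst (C := 1) fun p hp =>
    (one_mul ‖p.1‖).symm ▸ norm_le_of_mem_adjointGraph hp.1 hp.2
  have inner_eq : ∀ v w, inner A (T v).1 w =
      inner A (T v).1 (T w).1 + inner A (T v).2 (T w).2 :=
    fun v w => inner_eq_add_of_mem_adjointGraph (hT v).1 (hT w).2
  let R : Adjointable A E :=
    ⟨.fst ℂ E E ∘L T, .fst ℂ E E ∘L T, fun v w => by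
      change inner A (T v).1 w = inner A v (T w).1
      rw [← CStarModule.star_inner (T w).1, inner_eq, inner_eq w v, star_add,
        CStarModule.star_inner, CStarModule.star_inner]⟩
  obtain ⟨S, hS⟩ := exists_adjointable_of_mem_graph ht.dense_domain ht.dense_adjoint_domain R
    (T := .snd ℂ E E ∘L T) fun w => (hT w).1
  exact ⟨R, S, fun w => hS ▸ (hT w).1, fun w => hS ▸ (hT w).2⟩

namespace IsResolventPair

variable {R S : Adjointable A E}

theorem nonneg (h : IsResolventPair t R S) : 0 ≤ R := by
  refine Adjointable.nonneg_iff_inner_nonneg.2 fun w => ?_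
  rw [← CStarModule.star_inner, h.inner_eq (h.mem_graph w)]
  exact star_nonneg_iff.2 (add_nonneg CStarModule.inner_self_nonneg CStarModule.inner_self_nonneg)

theorem adj_left (h : IsResolventPair t R S) : R.adj = R.op :=
  congrArg Adjointable.op (IsSelfAdjoint.of_nonneg h.nonneg).star_eq

theorem op_add_adj (h : IsResolventPair t R S) {x u : E} (hxu : (x, u) ∈ t.graph) :
    R.op x + S.adj u = x := by
  refine (inner_ext_left (A := A) fun w => ?_).symm
  rw [h.inner_eq hxu, R.inner_op_right, h.adj_left, S.inner_op_right, CStarModule.inner_add_left]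

theorem adj_eq (h : IsResolventPair t R S) {v v' : E} (hv : (v, v') ∈ adjointGraph A t) :
    S.adj v = R.op v' := by
  refine inner_ext (A := A) fun y => ?_
  rw [← S.inner_op_left, HilbertModule.mem_adjointGraph.1 hv _ _ (h.mem_graph y),
    R.inner_op_left, h.adj_left]

theorem denseRange (h : IsResolventPair t R S) (hd : Dense (t.domain : Set E))
    (hd' : Dense ((padjoint A t).domain : Set E)) : DenseRange R.op := by
  let V : Submodule ℂ E := (LinearMap.range (R.op : E →ₗ[ℂ] E)).topologicalClosure
  have R_mem : ∀ x, R.op x ∈ V := fun x => subset_closure ⟨x, rfl⟩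
  have adj_mem : ∀ z, S.adj z ∈ V := fun z => by
    have isClosed_preimage : IsClosed (S.adj ⁻¹' (V : Set E)) :=
      (Submodule.isClosed_topologicalClosure _).preimage S.adj.continuous
    refine closure_minimal (fun v hv => ?_) isClosed_preimage (hd' z)
    obtain ⟨v', hvv'⟩ := LinearPMap.mem_domain_iff.1 hv
    rw [graph_padjoint hd] at hvv'
    exact (h.adj_eq hvv' ▸ R_mem v' : S.adj v ∈ V)
  refine dense_closure.1 (hd.mono fun x hx => ?_)
  obtain ⟨u, hxu⟩ := LinearPMap.mem_domain_iff.1 hx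
  exact h.op_add_adj hxu ▸ V.add_mem (R_mem x) (adj_mem u)

theorem norm_op_le_norm_sqrt (h : IsResolventPair t R S) (w : E) :
    ‖S.op w‖ ≤ ‖(CFC.sqrt R).op w‖ := by
  have star_mul_sqrt : star (CFC.sqrt R) * CFC.sqrt R = R := by
    rw [(IsSelfAdjoint.of_nonneg (CFC.sqrt_nonneg R)).star_eq, CFC.sqrt_mul_sqrt_self R h.nonneg]
  have inner_sqrt : inner A ((CFC.sqrt R).op w) ((CFC.sqrt R).op w) = inner A w (R.op w) := by
    nth_rw 3 [← star_mul_sqrt]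
    exact (CFC.sqrt R).inner_op_left w _
  refine norm_le_norm_of_inner_le (A := A) ?_
  rw [inner_sqrt, ← h.adj_left, ← R.inner_op_left, h.inner_eq (h.mem_graph w)]
  exact le_add_of_nonneg_left CStarModule.inner_self_nonneg

theorem sqrt_op_sqrt_op (h : IsResolventPair t R S) (x : E) :
    (CFC.sqrt R).op ((CFC.sqrt R).op x) = R.op x :=
  congrArg (fun T : Adjointable A E => T.op x) (CFC.sqrt_mul_sqrt_self R h.nonneg)

theorem denseRange_sqrt (h : IsResolventPair t R S) (hd : Dense (t.domain : Set E))
    (hd' : Dense ((padjoint A t).domain : Set E)) : DenseRange (CFC.sqrt R).op :=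
  (h.denseRange hd hd').mono <| by
    rintro _ ⟨x, rfl⟩
    exact ⟨_, h.sqrt_op_sqrt_op x⟩

theorem exists_mul_sqrt_eq (h : IsResolventPair t R S) (ht : t.IsClosed)
    (hd : Dense (t.domain : Set E)) (hd' : Dense ((padjoint A t).domain : Set E)) :
    ∃ F : Adjointable A E, F * CFC.sqrt R = S ∧
      ∀ y, ((CFC.sqrt R).op y, F.op y) ∈ t.graph := by
  have dense_sqrt := h.denseRange_sqrt hd hd'
  let T : E →L[ℂ] E := (S.op : E →ₗ[ℂ] E).extendOfNorm ((CFC.sqrt R).op : E →ₗ[ℂ] E)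
  have T_sqrt : ∀ w, T ((CFC.sqrt R).op w) = S.op w := fun w =>
    LinearMap.extendOfNorm_eq (f := (S.op : E →ₗ[ℂ] E)) (e := ((CFC.sqrt R).op : E →ₗ[ℂ] E))
      dense_sqrt ⟨1, fun w => by simpa using h.norm_op_le_norm_sqrt w⟩ w
  have mem_graph : ∀ y, ((CFC.sqrt R).op y, T y) ∈ t.graph := fun y =>
    dense_sqrt.induction_on y
      (IsClosed.preimage ((CFC.sqrt R).op.continuous.prodMk T.continuous) ht) fun w => by
        rw [h.sqrt_op_sqrt_op, T_sqrt]
        exact h.mem_graph w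
  obtain ⟨F, F_op⟩ := exists_adjointable_of_mem_graph hd hd' (CFC.sqrt R) mem_graph
  refine ⟨F, Adjointable.op_injective (ContinuousLinearMap.ext fun w => ?_), fun y => ?_⟩
  · rw [← T_sqrt, ← F_op]
    rfl
  · exact F_op ▸ mem_graph y

theorem isTransformPair (h : IsResolventPair t R S) (hd : Dense (t.domain : Set E))
    (hd' : Dense ((padjoint A t).domain : Set E)) {F : Adjointable A E}
    (hS : F * CFC.sqrt R = S) (hF : ∀ y, ((CFC.sqrt R).op y, F.op y) ∈ t.graph) :
    IsTransformPair t (CFC.sqrt R) F := by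
  have star_sqrt := (IsSelfAdjoint.of_nonneg (CFC.sqrt_nonneg R)).star_eq
  have inner_sqrt : ∀ x y, inner A ((CFC.sqrt R).op x) y = inner A x ((CFC.sqrt R).op y) :=
    fun x y => by rw [(CFC.sqrt R).inner_op_left, ← (CFC.sqrt R).op_star, star_sqrt]
  have injective_sqrt : ∀ {x y}, (CFC.sqrt R).op x = (CFC.sqrt R).op y → x = y :=
    fun {x y} hxy => inner_ext_of_dense (A := A) (h.denseRange_sqrt hd hd') <| by
      rintro _ ⟨z, rfl⟩
      rw [inner_sqrt, inner_sqrt, hxy]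
  have eq_sqrt_op : ∀ x u, (x, u) ∈ t.graph →
      x = (CFC.sqrt R).op ((CFC.sqrt R).op x + F.adj u) := fun x u hxu => by
    have S_adj : S.adj u = (CFC.sqrt R).op (F.adj u) := by
      rw [← S.op_star, ← hS, star_mul, star_sqrt]
      rfl
    rw [map_add, h.sqrt_op_sqrt_op, ← S_adj, h.op_add_adj hxu]
  refine ⟨CFC.sqrt_nonneg R, ?_, fun x u => ⟨fun hxu => ?_, ?_⟩⟩
  · exact Adjointable.op_injective <| ContinuousLinearMap.ext fun y =>
      (injective_sqrt (eq_sqrt_op _ _ (hF y))).symm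
  · have x_eq := eq_sqrt_op x u hxu
    exact ⟨_, x_eq, t.mem_graph_snd_inj hxu (hF _) x_eq⟩
  · rintro ⟨y, rfl, rfl⟩
    exact hF y

end IsResolventPair

theorem IsRegular.exists_isTransformPair (ht : IsRegular A t) :
    ∃ Q F : Adjointable A E, IsTransformPair t Q F := by
  obtain ⟨R, S, h⟩ := ht.exists_isResolventPair
  obtain ⟨F, hS, hF⟩ := h.exists_mul_sqrt_eq ht.isClosed ht.dense_domain ht.dense_adjoint_domain
  exact ⟨_, F, h.isTransformPair ht.dense_domain ht.dense_adjoint_domain hS hF⟩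

end Resolvent

section Fredholm

variable {A : Type*} [NonUnitalCStarAlgebra A] [PartialOrder A] [StarOrderedRing A]
variable {E : Type*} [NormedAddCommGroup E] [NormedSpace ℂ E] [SMul A E] [CStarModule A E]

theorem map_mem_of_mem_topologicalClosure_span {R X Y : Type*} [Semiring R]
    [AddCommMonoid X] [Module R X] [TopologicalSpace X] [ContinuousConstSMul R X] [ContinuousAdd X]
    [AddCommMonoid Y] [Module R Y] [TopologicalSpace Y] (L : X →L[R] Y) {V : Submodule R Y}
    (hV : IsClosed (V : Set Y)) {S : Set X} (h : ∀ x ∈ S, L x ∈ V) {x : X}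
    (hx : x ∈ (Submodule.span R S).topologicalClosure) : L x ∈ V :=
  Submodule.topologicalClosure_minimal (t := V.comap L.toLinearMap) _ (Submodule.span_le.2 h)
    (hV.preimage L.continuous) hx

theorem theta_apply (x y z : E) : theta A x y z = inner A x z • y := rfl

theorem theta_mem_moduleCompacts (x y : E) : theta A x y ∈ moduleCompacts A E :=
  Submodule.le_topologicalClosure _ (Submodule.subset_span ⟨x, y, rfl⟩)

theorem map_mem_of_mem_moduleCompacts {Y : Type*} [AddCommMonoid Y] [Module ℂ Y]
    [TopologicalSpace Y] (L : (E →L[ℂ] E) →L[ℂ] Y) {V : Submodule ℂ Y} (hV : IsClosed (V : Set Y))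
    (h : ∀ x y : E, L (theta A x y) ∈ V) {k : E →L[ℂ] E} (hk : k ∈ moduleCompacts A E) :
    L k ∈ V := by
  refine map_mem_of_mem_topologicalClosure_span L hV ?_ hk
  rintro _ ⟨x, y, rfl⟩
  exact h x y

namespace Adjointable

theorem op_mul_mem_moduleCompacts (T : Adjointable A E) {k : E →L[ℂ] E}
    (hk : k ∈ moduleCompacts A E) : T.op * k ∈ moduleCompacts A E := by
  refine map_mem_of_mem_moduleCompacts (ContinuousLinearMap.mul ℂ (E →L[ℂ] E) T.op)
    (Submodule.isClosed_topologicalClosure _) (fun x y => ?_) hk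
  have mul_theta : T.op * theta A x y = theta A x (T.op y) :=
    ContinuousLinearMap.ext fun z => T.op_act _ _
  rw [ContinuousLinearMap.mul_apply', mul_theta]
  exact theta_mem_moduleCompacts _ _

theorem mul_op_mem_moduleCompacts (T : Adjointable A E) {k : E →L[ℂ] E}
    (hk : k ∈ moduleCompacts A E) : k * T.op ∈ moduleCompacts A E := by
  refine map_mem_of_mem_moduleCompacts ((ContinuousLinearMap.mul ℂ (E →L[ℂ] E)).flip T.op)
    (Submodule.isClosed_topologicalClosure _) (fun x y => ?_) hk
  have theta_mul : theta A x y * T.op = theta A (T.adj x) y :=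
    ContinuousLinearMap.ext fun z => by
      rw [mul_apply_eq_comp, theta_apply, theta_apply, T.inner_op_right]
  rw [ContinuousLinearMap.flip_apply, ContinuousLinearMap.mul_apply', theta_mul]
  exact theta_mem_moduleCompacts _ _

theorem exists_op_eq_of_mem_span_theta {T : E →L[ℂ] E}
    (hT : T ∈ Submodule.span ℂ {T : E →L[ℂ] E | ∃ x y : E, T = theta A x y}) :
    ∃ S : Adjointable A E, S.op = T ∧ S.adj ∈ moduleCompacts A E := by
  induction hT using Submodule.span_induction with
  | mem T hT =>
    obtain ⟨x, y, rfl⟩ := hT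
    exact ⟨⟨theta A x y, theta A y x, fun z w => by simp [theta_apply]⟩, rfl,
      theta_mem_moduleCompacts y x⟩
  | zero => exact ⟨0, rfl, Submodule.zero_mem _⟩
  | add T S _ _ hT hS =>
    obtain ⟨T, rfl, hT⟩ := hT
    obtain ⟨S, rfl, hS⟩ := hS
    exact ⟨T + S, rfl, Submodule.add_mem _ hT hS⟩
  | smul c T _ hT =>
    obtain ⟨T, rfl, hT⟩ := hT
    exact ⟨c • T, rfl, Submodule.smul_mem _ _ hT⟩

variable [CompleteSpace E]

theorem adj_mem_moduleCompacts {T : Adjointable A E} (hT : T.op ∈ moduleCompacts A E) :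
    T.adj ∈ moduleCompacts A E := by
  have closure_eq : closure (moduleCompacts A E : Set (E →L[ℂ] E)) = moduleCompacts A E :=
    (Submodule.isClosed_topologicalClosure _).closure_eq
  refine closure_eq.subset (Metric.mem_closure_iff.2 fun ε hε => ?_)
  obtain ⟨_, hS, dist_lt⟩ := Metric.mem_closure_iff.1 hT ε hε
  obtain ⟨S, rfl, S_adj⟩ := exists_op_eq_of_mem_span_theta hS
  refine ⟨S.adj, S_adj, ?_⟩
  calc dist T.adj S.adj = ‖star (T - S)‖ := dist_eq_norm _ _
    _ = ‖T - S‖ := norm_star _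
    _ = dist T.op S.op := (dist_eq_norm _ _).symm
    _ < ε := dist_lt

theorem IsFredholm.conj {T : Adjointable A E} (hT : T.IsFredholm) : T.conj.IsFredholm := by
  obtain ⟨⟨S, hS⟩, S', hS'⟩ := hT
  refine ⟨⟨star S', ?_⟩, star S, ?_⟩
  · have adj_mem := adj_mem_moduleCompacts (T := T * S' - 1) hS'
    rwa [← op_star, star_sub, star_mul, star_one] at adj_mem
  · have adj_mem := adj_mem_moduleCompacts (T := S * T - 1) hS
    rwa [← op_star, star_sub, star_mul, star_one] at adj_mem

end Adjointable

theorem IsPseudoLeftInverse.exists_comp_eq {t : E →ₗ.[ℂ] E} {G : Adjointable A E}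
    (hG : IsPseudoLeftInverse G t) : ∃ S : Adjointable A E, (S - 1).op ∈ moduleCompacts A E ∧
      ∀ x u, (x, u) ∈ t.graph → G.op u = S.op x := by
  obtain ⟨-, S, closure_eq, hS⟩ := hG
  refine ⟨S, hS, fun x u hxu => mem_graph_toPMap.1 ?_⟩
  rw [← closure_eq]
  exact LinearPMap.le_graph_of_le (LinearPMap.le_closure _)
    (mem_graph_pcomp.2 ⟨u, hxu, mem_graph_toPMap.2 rfl⟩)

theorem IsPseudoRightInverse.exists_mem_graph {t : E →ₗ.[ℂ] E} (ht : t.IsClosed)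
    {G : Adjointable A E} (hG : IsPseudoRightInverse G t) :
    ∃ S : Adjointable A E, (S - 1).op ∈ moduleCompacts A E ∧
      ∀ x, (G.op x, S.op x) ∈ t.graph := by
  obtain ⟨isClosable, S, closure_eq, hS⟩ := hG
  have pcomp_eq : pcomp t G.toPMap = S.toPMap := by
    refine closure_eq ▸ LinearPMap.eq_of_eq_graph ?_
    rw [← isClosable.graph_closure_eq_closure_graph]
    exact (IsClosed.submodule_topologicalClosure_eq (isClosed_pcomp_toPMap ht G)).symm
  refine ⟨S, hS, fun x => ?_⟩
  obtain ⟨_, hG, hxS⟩ := mem_graph_pcomp.1 (pcomp_eq ▸ mem_graph_toPMap.2 rfl :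
    (x, S.op x) ∈ (pcomp t G.toPMap).graph)
  exact mem_graph_toPMap.1 hG ▸ hxS

variable [CompleteSpace E]

theorem IsTransformPair.isFredholm {t : E →ₗ.[ℂ] E} {Q F : Adjointable A E}
    (h : IsTransformPair t Q F) (ht : t.IsClosed) (htF : IsFredholm A t) : F.IsFredholm := by
  obtain ⟨⟨G, hG⟩, G', hG'⟩ := htF
  constructor
  · obtain ⟨S, hS, G_comp⟩ := hG.exists_comp_eq
    have G_mul_F : G * F = S * Q := Adjointable.op_injective <| ContinuousLinearMap.ext fun y =>
      G_comp _ _ ((h.mem_graph_iff _ _).2 ⟨y, rfl, rfl⟩)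
    have left_inverse : (star F + Q * G) * F - 1 = Q * (S - 1) * Q := by
      rw [add_mul, mul_assoc, G_mul_F, eq_sub_of_add_eq' h.mul_self_add]
      noncomm_ring
    refine ⟨star F + Q * G, ?_⟩
    change ((star F + Q * G) * F - 1).op ∈ _
    rw [left_inverse]
    exact Q.mul_op_mem_moduleCompacts (Q.op_mul_mem_moduleCompacts hS)
  · obtain ⟨S, hS, mem_graph⟩ := hG'.exists_mem_graph ht
    have right_inverse : F * (Q * G' + star F * S) = S :=
      Adjointable.op_injective <| ContinuousLinearMap.ext fun x => by
        obtain ⟨y, hG'y, hSy⟩ := (h.mem_graph_iff _ _).1 (mem_graph x)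
        change F.op (Q.op (G'.op x) + F.adj (S.op x)) = S.op x
        rw [hG'y, hSy, h.op_op_add]
    refine ⟨Q * G' + star F * S, ?_⟩
    change (F * (Q * G' + star F * S) - 1).op ∈ _
    rwa [right_inverse]

end Fredholm

section Action

variable {A : Type*} [NonUnitalCStarAlgebra A] [PartialOrder A]
variable {E : Type*} [NormedAddCommGroup E] [NormedSpace ℂ E] [SMul A E] [CStarModule A E]

theorem smul_act (c : ℂ) (a : A) (x : E) : (c • a) • x = c • (a • x) :=
  inner_ext (A := A) fun z => by simp [smul_mul_assoc]

theorem mul_act (a b : A) (x : E) : (a * b) • x = a • (b • x) :=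
  inner_ext (A := A) fun z => by simp [mul_assoc]

theorem sum_act {ι : Type*} (s : Finset ι) (a : ι → A) (x : E) :
    (∑ i ∈ s, a i) • x = ∑ i ∈ s, a i • x :=
  inner_ext (A := A) fun z => by simp [Finset.sum_mul]

/-- The action of `a : A` on a Hilbert `A`-module, as a bounded operator. -/
def act (a : A) : E →L[ℂ] E :=
  LinearMap.mkContinuous
    { toFun := fun x => a • x
      map_add' := fun x y => inner_ext (A := A) fun z => by simp [mul_add]
      map_smul' := fun c x => inner_ext (A := A) fun z => by simp [mul_smul_comm] }
    ‖a‖ fun x => norm_act_le a x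

@[simp] theorem act_apply (a : A) (x : E) : act a x = a • x := rfl

theorem inner_act_act (a b : A) (x y : E) :
    inner A (a • x) (b • y) = b * inner A x y * star a := by
  rw [CStarModule.inner_op_smul_left, CStarModule.inner_op_smul_right]

theorem inner_self_act_self {x : E} (h : IsIdempotentElem (inner A x x)) :
    inner A x x • x = x := by
  rw [← sub_eq_zero, ← CStarModule.inner_self (A := A)]
  simp [h.eq]

end Action

section CompactOperators

theorem isCompactOperator_of_forall_mem {𝕜 V W : Type*} [NontriviallyNormedField 𝕜]
    [LocallyCompactSpace 𝕜] [SeminormedAddCommGroup V] [NormedSpace 𝕜 V] [NormedAddCommGroup W]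
    [NormedSpace 𝕜 W] (T : V →L[𝕜] W) (U : Submodule 𝕜 W) [FiniteDimensional 𝕜 U]
    (h : ∀ x, T x ∈ U) : IsCompactOperator T :=
  have : ProperSpace U := FiniteDimensional.proper 𝕜 U
  (isCompactOperator_of_locallyCompactSpace_dom (T.codRestrict U h)).clm_comp U.subtypeL

theorem norm_one_sub_starProjection_le {𝕜 V : Type*} [RCLike 𝕜] [NormedAddCommGroup V]
    [InnerProductSpace 𝕜 V] (W : Submodule 𝕜 V) [W.HasOrthogonalProjection] :
    ‖1 - W.starProjection‖ ≤ 1 := by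
  rw [← Submodule.starProjection_orthogonal']
  exact Submodule.starProjection_norm_le _

theorem exists_norm_one_sub_starProjection_comp_le {𝕜 U V : Type*} [RCLike 𝕜]
    [NormedAddCommGroup U] [NormedSpace 𝕜 U] [NormedAddCommGroup V] [InnerProductSpace 𝕜 V]
    {T : U →L[𝕜] V} (hT : IsCompactOperator T) {ε : ℝ} (hε : 0 < ε) :
    ∃ (W : Submodule 𝕜 V) (_ : FiniteDimensional 𝕜 W), ‖(1 - W.starProjection) ∘L T‖ ≤ ε := by
  have totallyBounded : TotallyBounded (T '' Metric.closedBall 0 1) :=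
    (hT.isCompact_closure_image_closedBall (f := (T : U →ₗ[𝕜] V)) 1).totallyBounded.subset
      subset_closure
  obtain ⟨s, finite_s, cover⟩ := Metric.totallyBounded_iff.1 totallyBounded ε hε
  have : FiniteDimensional 𝕜 (Submodule.span 𝕜 s) := FiniteDimensional.span_of_finite 𝕜 finite_s
  refine ⟨Submodule.span 𝕜 s, this, ContinuousLinearMap.opNorm_le_of_unit_norm hε.le fun x hx => ?_⟩
  set P := (Submodule.span 𝕜 s).starProjection
  obtain ⟨y, hy, hxy⟩ := Set.mem_iUnion₂.1 (cover ⟨x, by simp [hx], rfl⟩)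
  have P_y : P y = y := Submodule.starProjection_eq_self_iff.2 (Submodule.subset_span hy)
  calc ‖((1 - P) ∘L T) x‖ = ‖(1 - P) (T x - y)‖ := by simp [P_y]
    _ ≤ 1 * ‖T x - y‖ :=
        ContinuousLinearMap.le_of_opNorm_le _ (norm_one_sub_starProjection_le _) _
    _ ≤ ε := by
        rw [one_mul, ← dist_eq_norm]
        exact (Metric.mem_ball.1 hxy).le

variable {H : Type*} [NormedAddCommGroup H] [InnerProductSpace ℂ H] [CompleteSpace H]

namespace CompactOp

/-- The inclusion of `𝒦(H)` into the bounded operators on `H`. -/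
def toCLM : CompactOp H →⋆ₙₐ[ℂ] (H →L[ℂ] H) :=
  NonUnitalStarSubalgebraClass.subtype (compactSubalgebra H)

theorem ext {a b : CompactOp H} (h : ∀ x, toCLM a x = toCLM b x) : a = b :=
  Subtype.ext (ContinuousLinearMap.ext h)

theorem norm_toCLM (a : CompactOp H) : ‖toCLM a‖ = ‖a‖ := rfl

theorem isCompactOperator (a : CompactOp H) : IsCompactOperator (toCLM a) := a.2

theorem inner_star_left (a : CompactOp H) (x y : H) :
    inner ℂ (toCLM (star a) x) y = inner ℂ x (toCLM a y) :=
  ContinuousLinearMap.adjoint_inner_left (toCLM a) y x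

open ComplexOrder in
theorem inner_toCLM_nonneg {a : CompactOp H} (ha : 0 ≤ a) (x : H) :
    0 ≤ inner ℂ x (toCLM a x) := by
  obtain ⟨b, rfl⟩ := CStarAlgebra.nonneg_iff_eq_star_mul_self.1 ha
  rw [map_mul, mul_apply_eq_comp, ← inner_star_left, star_star, inner_self_eq_norm_sq_to_K]
  positivity

end CompactOp

open CompactOp

/-- The rank one operator `ζ ↦ ⟨η, ζ⟩ ξ`, written `|ξ⟩⟨η|` in physics. -/
def ketBra (ξ η : H) : CompactOp H :=
  ⟨InnerProductSpace.rankOne ℂ ξ η,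
    isCompactOperator_of_forall_mem _ (Submodule.span ℂ {ξ}) fun _ =>
      Submodule.smul_mem _ _ (Submodule.mem_span_singleton_self ξ)⟩

@[simp] theorem ketBra_apply (ξ η x : H) : toCLM (ketBra ξ η) x = inner ℂ η x • ξ := rfl

@[simp] theorem star_ketBra (ξ η : H) : star (ketBra ξ η) = ketBra η ξ :=
  Subtype.ext (InnerProductSpace.adjoint_rankOne ξ η)

theorem norm_ketBra (ξ η : H) : ‖ketBra ξ η‖ = ‖ξ‖ * ‖η‖ :=
  InnerProductSpace.norm_rankOne ξ η

theorem ketBra_mul_mul_ketBra (ξ η ζ θ : H) (a : CompactOp H) :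
    ketBra ξ η * a * ketBra ζ θ = inner ℂ η (toCLM a ζ) • ketBra ξ θ :=
  CompactOp.ext fun x => by
    simp only [map_mul, map_smul, mul_apply_eq_comp, ketBra_apply, smul_apply,
      smul_smul, mul_comm]

theorem ketBra_mul_ketBra {η : H} (hη : ‖η‖ = 1) (ξ θ : H) :
    ketBra ξ η * ketBra η θ = ketBra ξ θ :=
  CompactOp.ext fun x => by
    simp [inner_self_eq_norm_sq_to_K, hη]

theorem ketBra_self_ne_zero {ξ : H} (hξ : ‖ξ‖ = 1) : ketBra ξ ξ ≠ 0 := by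
  rw [← norm_ne_zero_iff, norm_ketBra, hξ]
  norm_num

theorem isMinimalProjection_ketBra {ξ : H} (hξ : ‖ξ‖ = 1) : IsMinimalProjection (ketBra ξ ξ) :=
  ⟨⟨ketBra_mul_ketBra hξ ξ ξ, star_ketBra ξ ξ⟩, ketBra_self_ne_zero hξ,
    fun a => ⟨_, ketBra_mul_mul_ketBra ξ ξ ξ ξ a⟩⟩

theorem exists_norm_eq_one_toCLM_eq_self {p : CompactOp H} (hp : IsIdempotentElem p)
    (hp0 : p ≠ 0) : ∃ η : H, ‖η‖ = 1 ∧ toCLM p η = η := by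
  obtain ⟨x, hx⟩ : ∃ x, toCLM p x ≠ 0 := by
    by_contra! h
    exact hp0 (CompactOp.ext fun x => by rw [h, map_zero, zero_apply])
  refine ⟨((‖toCLM p x‖⁻¹ : ℝ) : ℂ) • toCLM p x, ?_, ?_⟩
  · simp [norm_smul, norm_ne_zero_iff.2 hx]
  · rw [map_smul, ← mul_apply_eq_comp, ← map_mul, hp.eq]

theorem IsMinimalProjection.exists_eq_ketBra {p : CompactOp H} (hp : IsMinimalProjection p) :
    ∃ η : H, ‖η‖ = 1 ∧ p = ketBra η η := by
  obtain ⟨isStarProjection, ne_zero, minimal⟩ := hp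
  obtain ⟨η, norm_η, p_η⟩ :=
    exists_norm_eq_one_toCLM_eq_self isStarProjection.isIdempotentElem ne_zero
  obtain ⟨c, hc⟩ := minimal (ketBra η η)
  have compression : p * ketBra η η * p = ketBra η η := CompactOp.ext fun z => by
    simp only [map_mul, mul_apply_eq_comp, ketBra_apply, map_smul, p_η, ← inner_star_left,
      isStarProjection.isSelfAdjoint.star_eq]
  have ketBra_eq : ketBra η η = c • p := compression ▸ hc
  have c_eq_one : c = 1 := by
    have smul_η : c • η = η := by
      simpa [p_η, inner_self_eq_norm_sq_to_K, norm_η] using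
        (congrArg (fun a : CompactOp H => toCLM a η) ketBra_eq).symm
    have η_ne_zero : η ≠ 0 := norm_ne_zero_iff.1 (norm_η ▸ one_ne_zero)
    exact smul_left_injective ℂ η_ne_zero (smul_η.trans (one_smul ℂ η).symm)
  exact ⟨η, norm_η, by rw [ketBra_eq, c_eq_one, one_smul]⟩

variable {E : Type*} [NormedAddCommGroup E] [NormedSpace ℂ E]
  [SMul (CompactOp H) E] [CStarModule (CompactOp H) E]

theorem norm_sub_act_sq_le {p : CompactOp H} (hp : star p = p) (hp1 : ‖1 - toCLM p‖ ≤ 1) (x : E) :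
    ‖x - p • x‖ ^ 2 ≤ ‖(1 - toCLM p) * toCLM (inner (CompactOp H) x x)‖ := by
  have inner_eq : toCLM (inner (CompactOp H) (x - p • x) (x - p • x)) =
      (1 - toCLM p) * toCLM (inner (CompactOp H) x x) * (1 - toCLM p) := by
    simp only [CStarModule.inner_sub_left, CStarModule.inner_sub_right,
      CStarModule.inner_op_smul_left, CStarModule.inner_op_smul_right, hp, map_sub, map_mul]
    noncomm_ring
  rw [CStarModule.norm_sq_eq (CompactOp H), ← norm_toCLM, inner_eq]
  exact (norm_mul_le _ _).trans (mul_le_of_le_one_right (norm_nonneg _) hp1)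

theorem mem_closure_span_ketBra (x : E) :
    x ∈ (Submodule.span ℂ (Set.range fun ζ : H => ketBra ζ ζ • x)).topologicalClosure := by
  refine Metric.mem_closure_iff.2 fun ε hε => ?_
  obtain ⟨W, _, norm_le⟩ := exists_norm_one_sub_starProjection_comp_le
    (inner (CompactOp H) x x).isCompactOperator (ε := ε ^ 2 / 2) (by positivity)
  let b := stdOrthonormalBasis ℂ W
  let p : CompactOp H := ∑ i, ketBra (b i : H) (b i : H)
  have toCLM_p : toCLM p = W.starProjection := by
    rw [b.starProjection_eq_sum_rankOne, map_sum]
    rfl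
  have star_p : star p = p := by simp only [p, star_sum, star_ketBra]
  have norm_sq_le : ‖x - p • x‖ ^ 2 ≤ ε ^ 2 / 2 := by
    rw [← toCLM_p] at norm_le
    exact (norm_sub_act_sq_le star_p (toCLM_p ▸ norm_one_sub_starProjection_le W) x).trans norm_le
  refine ⟨p • x, ?_, ?_⟩
  · rw [sum_act]
    exact Submodule.sum_mem _ fun i _ => Submodule.subset_span ⟨_, rfl⟩
  · rw [dist_eq_norm]
    exact lt_of_pow_lt_pow_left₀ 2 hε.le (norm_sq_le.trans_lt (half_lt_self (by positivity)))

end CompactOperators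

section Corner

variable {A : Type*} [NonUnitalCStarAlgebra A] [PartialOrder A]
variable {E : Type*} [NormedAddCommGroup E] [NormedSpace ℂ E] [SMul A E] [CStarModule A E]

/-- The corner `e X` of a submodule `X`, for a projection `e`. It is encoded as the set of those
vectors of `X` that are fixed by `e`. -/
def corner (e : A) (X : Submodule ℂ E) : Submodule ℂ E :=
  X ⊓ LinearMap.eqLocus (act e).toLinearMap LinearMap.id

theorem mem_corner {e : A} {X : Submodule ℂ E} {x : E} : x ∈ corner e X ↔ x ∈ X ∧ e • x = x :=
  Iff.rfl

theorem isClosed_corner (e : A) {X : Submodule ℂ E} (hX : IsClosed (X : Set E)) :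
    IsClosed (corner e X : Set E) :=
  hX.inter (isClosed_eq (act e).continuous continuous_id)

theorem act_mem_corner {e a : A} (ha : e * a = a) {X : Submodule ℂ E}
    (hX : ∀ (a : A), ∀ x ∈ X, a • x ∈ X) {x : E} (hx : x ∈ X) : a • x ∈ corner e X :=
  mem_corner.2 ⟨hX a x hx, by rw [← mul_act, ha]⟩

end Corner

section ThetaRight

variable {A : Type*} [NonUnitalCStarAlgebra A] [PartialOrder A] [StarOrderedRing A]
variable {E : Type*} [NormedAddCommGroup E] [NormedSpace ℂ E] [SMul A E] [CStarModule A E]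

theorem norm_theta_le (x y : E) : ‖theta A x y‖ ≤ ‖x‖ * ‖y‖ :=
  LinearMap.mkContinuous_norm_le _ (by positivity) _

variable (A) in
/-- The operator `Θ_{x,y}` as a bounded linear function of `y`. -/
def thetaRight (x : E) : E →L[ℂ] E →L[ℂ] E :=
  LinearMap.mkContinuous
    { toFun := fun y => theta A x y
      map_add' := fun y y' => ContinuousLinearMap.ext fun z => (act (inner A x z)).map_add y y'
      map_smul' := fun c y => ContinuousLinearMap.ext fun z => (act (inner A x z)).map_smul c y }
    ‖x‖ fun y => norm_theta_le x y

end ThetaRight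

section CornerCompactness

variable {H : Type*} [NormedAddCommGroup H] [InnerProductSpace ℂ H] [CompleteSpace H]
variable {E : Type*} [NormedAddCommGroup E] [NormedSpace ℂ E]
  [SMul (CompactOp H) E] [CStarModule (CompactOp H) E]

theorem theta_ketBra_act_ketBra_act (ξ η ζ θ : H) (x y z : E) :
    theta (CompactOp H) x (ketBra ζ θ • y) (ketBra ξ η • z) =
      inner ℂ η (CompactOp.toCLM (inner (CompactOp H) x z) ζ) • ketBra ξ θ • y := by
  rw [theta_apply, CStarModule.inner_op_smul_right, ← mul_act, ketBra_mul_mul_ketBra, smul_act]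

variable [CompleteSpace E]

theorem isCompactOperator_theta_comp_act (ξ η : H) (x y : E) :
    IsCompactOperator (theta (CompactOp H) x y ∘L act (ketBra ξ η)) := by
  let precomp : (E →L[ℂ] E) →L[ℂ] E →L[ℂ] E :=
    (ContinuousLinearMap.compL ℂ E E E).flip (act (ketBra ξ η))
  refine map_mem_of_mem_topologicalClosure_span (V := compactOperator (RingHom.id ℂ) E E)
    (precomp ∘L thetaRight (CompactOp H) x) isClosed_setOfPred_isCompactOperator ?_
    (mem_closure_span_ketBra (H := H) y)
  rintro _ ⟨ζ, rfl⟩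
  refine isCompactOperator_of_forall_mem (theta (CompactOp H) x (ketBra ζ ζ • y) ∘L
    act (ketBra ξ η)) (Submodule.span ℂ {ketBra ξ ζ • y}) fun z => ?_
  rw [ContinuousLinearMap.comp_apply, act_apply, theta_ketBra_act_ketBra_act]
  exact Submodule.smul_mem _ _ (Submodule.mem_span_singleton_self _)

theorem isCompactOperator_comp_act (ξ η : H) {k : E →L[ℂ] E}
    (hk : k ∈ moduleCompacts (CompactOp H) E) : IsCompactOperator (k ∘L act (ketBra ξ η)) :=
  map_mem_of_mem_moduleCompacts (V := compactOperator (RingHom.id ℂ) E E)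
    ((ContinuousLinearMap.compL ℂ E E E).flip (act (ketBra ξ η)))
    isClosed_setOfPred_isCompactOperator (isCompactOperator_theta_comp_act ξ η) hk

theorem finiteDimensional_corner (ξ : H) {X : Submodule ℂ E}
    (hX : IsClosed (X : Set E)) {k : E →L[ℂ] E} (hk : k ∈ moduleCompacts (CompactOp H) E)
    (hkX : ∀ x ∈ X, k x = x) : FiniteDimensional ℂ (corner (ketBra ξ ξ) X) := by
  let T : E →L[ℂ] E := k ∘L act (ketBra ξ ξ)
  have T_eq : ∀ x ∈ corner (ketBra ξ ξ) X, T x = x := fun x hx => by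
    rw [ContinuousLinearMap.comp_apply, act_apply, (mem_corner.1 hx).2, hkX x (mem_corner.1 hx).1]
  have T_mem : ∀ x ∈ corner (ketBra ξ ξ) X, T x ∈ corner (ketBra ξ ξ) X :=
    fun x hx => (T_eq x hx).symm ▸ hx
  have isCompactOperator_restrict : IsCompactOperator ((T : E →ₗ[ℂ] E).restrict T_mem) :=
    (isCompactOperator_comp_act ξ ξ hk).restrict (f := (T : E →ₗ[ℂ] E)) T_mem
      (isClosed_corner _ hX)
  have restrict_eq : ⇑((T : E →ₗ[ℂ] E).restrict T_mem) = id :=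
    funext fun x => Subtype.ext (T_eq x x.2)
  exact FiniteDimensional.of_isCompactOperator_id (𝕜 := ℂ)
    (restrict_eq ▸ isCompactOperator_restrict)

end CornerCompactness

theorem mk_eq_finrank_of_hilbertBasis {ι 𝕜 V : Type*} [RCLike 𝕜] [NormedAddCommGroup V]
    [InnerProductSpace 𝕜 V] [FiniteDimensional 𝕜 V] (b : HilbertBasis ι 𝕜 V) :
    Cardinal.mk ι = Module.finrank 𝕜 V := by
  have : Finite ι := LinearIndependent.finite b.orthonormal.linearIndependent
  have : Fintype ι := Fintype.ofFinite ι
  rw [Module.finrank_eq_card_basis b.toOrthonormalBasis.toBasis, Cardinal.mk_fintype]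

theorem hasOrthonormalDim_zero_of_subsingleton {A : Type*} [NonUnitalCStarAlgebra A]
    [PartialOrder A] [Subsingleton A] {E : Type*} [NormedAddCommGroup E]
    [NormedSpace ℂ E] [SMul A E] [CStarModule A E] (X : Submodule ℂ E) :
    HasOrthonormalDim A X 0 := by
  have : Subsingleton E := ⟨fun x y => inner_ext (A := A) fun _ => Subsingleton.elim _ _⟩
  refine ⟨⟨∅, by simp, by simp, Subsingleton.elim _ _⟩, fun B hB => ?_⟩
  have B_eq : B = ∅ := Set.eq_empty_of_forall_notMem fun x hx =>
    (hB.basic x hx).2.1 (Subsingleton.elim _ _)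
  rw [B_eq, Cardinal.mk_eq_zero]

section Dimension

variable {H : Type*} [NormedAddCommGroup H] [InnerProductSpace ℂ H] [CompleteSpace H]
variable {E : Type*} [NormedAddCommGroup E] [NormedSpace ℂ E]
  [SMul (CompactOp H) E] [CStarModule (CompactOp H) E]
variable {ξ : Metric.sphere (0 : H) 1} {X : Submodule ℂ E}

theorem inner_eq_smul_ketBra {ξ : H} {x y : E} (hx : x ∈ corner (ketBra ξ ξ) X)
    (hy : y ∈ corner (ketBra ξ ξ) X) : inner (CompactOp H) x y =
      inner ℂ ξ (CompactOp.toCLM (inner (CompactOp H) x y) ξ) • ketBra ξ ξ := by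
  conv_lhs => rw [← (mem_corner.1 hx).2, ← (mem_corner.1 hy).2]
  rw [inner_act_act, star_ketBra, ketBra_mul_mul_ketBra]

open ComplexOrder in
/-- The corner of `X` at the projection onto a unit vector `ξ` is an inner product space: the
`𝒦(H)`-valued inner product of its vectors is a multiple of the projection. -/
instance : InnerProductSpace ℂ (corner (ketBra (ξ : H) ξ) X) where
  inner x y := inner ℂ (ξ : H) (CompactOp.toCLM (inner (CompactOp H) (x : E) (y : E)) ξ)
  norm_sq_eq_re_inner x := by
    have nonneg := CompactOp.inner_toCLM_nonneg
      (CStarModule.inner_self_nonneg (A := CompactOp H) (x := (x : E))) ξ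
    rw [RCLike.re_eq_complex_re, Complex.re_eq_norm.2 nonneg, Submodule.coe_norm,
      CStarModule.norm_sq_eq (CompactOp H)]
    conv_lhs => rw [inner_eq_smul_ketBra x.2 x.2, norm_smul, norm_ketBra, norm_eq_of_mem_sphere ξ]
    rw [mul_one, mul_one]
  conj_inner_symm x y := by
    rw [inner_conj_symm, ← CompactOp.inner_star_left, CStarModule.star_inner]
  add_left x y z := by simp
  smul_left x y c := by simp

theorem inner_corner (x y : corner (ketBra (ξ : H) ξ) X) :
    inner (CompactOp H) (x : E) (y : E) = (inner ℂ x y : ℂ) • ketBra (ξ : H) ξ :=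
  inner_eq_smul_ketBra x.2 y.2

theorem orthonormal_corner_iff {ι : Type*} {v : ι → corner (ketBra (ξ : H) ξ) X} :
    Orthonormal ℂ v ↔ (∀ i, inner (CompactOp H) (v i : E) (v i : E) = ketBra (ξ : H) ξ) ∧
      Pairwise fun i j => inner (CompactOp H) (v i : E) (v j : E) = 0 := by
  have ketBra_ne_zero := ketBra_self_ne_zero (norm_eq_of_mem_sphere ξ)
  have norm_eq_one_iff (x : corner (ketBra (ξ : H) ξ) X) :
      ‖x‖ = 1 ↔ inner (CompactOp H) (x : E) (x : E) = ketBra (ξ : H) ξ := by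
    refine ⟨fun h => ?_, fun h => ?_⟩
    · rw [inner_corner, inner_self_eq_one_of_norm_eq_one h, one_smul]
    · rw [← pow_eq_one_iff_of_nonneg (norm_nonneg x) two_ne_zero, Submodule.coe_norm,
        CStarModule.norm_sq_eq (CompactOp H), h, norm_ketBra, norm_eq_of_mem_sphere ξ, one_mul]
  have inner_eq_zero_iff (x y : corner (ketBra (ξ : H) ξ) X) :
      inner ℂ x y = 0 ↔ inner (CompactOp H) (x : E) (y : E) = 0 := by
    rw [inner_corner, smul_eq_zero_iff_left ketBra_ne_zero]
  simp only [Orthonormal, norm_eq_one_iff, inner_eq_zero_iff]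

theorem le_of_act_corner_mem (ξ : Metric.sphere (0 : H) 1)
    (hX : ∀ (a : CompactOp H), ∀ x ∈ X, a • x ∈ X) {M : Submodule ℂ E}
    (hM : IsClosed (M : Set E))
    (h : ∀ (a : CompactOp H), ∀ x ∈ corner (ketBra (ξ : H) ξ) X, a • x ∈ M) : X ≤ M := by
  intro x hx
  refine map_mem_of_mem_topologicalClosure_span (ContinuousLinearMap.id ℂ E) hM ?_
    (mem_closure_span_ketBra (H := H) x)
  rintro _ ⟨ζ, rfl⟩
  have ketBra_mul := ketBra_mul_ketBra (norm_eq_of_mem_sphere ξ)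
  have mem_M := h (ketBra ζ ξ) _ (act_mem_corner (ketBra_mul ξ ζ) hX hx)
  rwa [← mul_act, ketBra_mul] at mem_M

theorem isOrthonormalBasis_range_hilbertBasis {ι : Type*} (hXc : IsClosed (X : Set E))
    (hX : ∀ (a : CompactOp H), ∀ x ∈ X, a • x ∈ X)
    (b : HilbertBasis ι ℂ (corner (ketBra (ξ : H) ξ) X)) :
    IsOrthonormalBasis (CompactOp H) X (Set.range fun i => (b i : E)) := by
  obtain ⟨inner_self, orthogonal⟩ := orthonormal_corner_iff.1 b.orthonormal
  refine ⟨?_, ?_, le_antisymm ?_ ?_⟩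
  · rintro _ ⟨i, rfl⟩
    exact (inner_self i).symm ▸ isMinimalProjection_ketBra (norm_eq_of_mem_sphere ξ)
  · rintro _ ⟨i, rfl⟩ _ ⟨j, rfl⟩ ne
    exact orthogonal fun hij => ne (hij ▸ rfl)
  · refine Submodule.topologicalClosure_minimal _ (Submodule.span_le.2 ?_) hXc
    rintro _ (⟨i, rfl⟩ | ⟨a, _, ⟨i, rfl⟩, rfl⟩)
    · exact (mem_corner.1 (b i).2).1
    · exact hX a _ (mem_corner.1 (b i).2).1
  · refine le_of_act_corner_mem ξ hX (Submodule.isClosed_topologicalClosure _) fun a x hx => ?_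
    refine map_mem_of_mem_topologicalClosure_span
      (act a ∘L (corner (ketBra (ξ : H) ξ) X).subtypeL) (Submodule.isClosed_topologicalClosure _) ?_
      (b.dense_span.ge Submodule.mem_top : ⟨x, hx⟩ ∈ _)
    rintro _ ⟨i, rfl⟩
    exact Submodule.le_topologicalClosure _
      (Submodule.subset_span (Or.inr ⟨a, _, ⟨i, rfl⟩, rfl⟩))

theorem ketBra_act_act {η : H} {x : E} (hη : ‖η‖ = 1)
    (hx : inner (CompactOp H) x x = ketBra η η) (ξ θ : H) (a : CompactOp H) :
    ketBra θ ξ • a • x = inner ℂ ξ (CompactOp.toCLM a η) • ketBra θ η • x := by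
  have ketBra_act : ketBra η η • x = x :=
    hx ▸ inner_self_act_self (hx.symm ▸ ketBra_mul_ketBra hη η η)
  rw [← smul_act, ← ketBra_mul_mul_ketBra, mul_act, mul_act, ketBra_act]

theorem IsOrthonormalBasis.mem {B : Set E} (hB : IsOrthonormalBasis (CompactOp H) X B) {x : E}
    (hx : x ∈ B) : x ∈ X :=
  hB.dense_span.le (Submodule.le_topologicalClosure _ (Submodule.subset_span (Or.inl hx)))

theorem IsOrthonormalBasis.ketBra_act_mem {B : Set E} (hB : IsOrthonormalBasis (CompactOp H) X B)
    {η : E → H} (norm_η : ∀ x ∈ B, ‖η x‖ = 1)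
    (inner_self : ∀ x ∈ B, inner (CompactOp H) x x = ketBra (η x) (η x)) (ξ : H) {z : E}
    (hz : z ∈ X) : ketBra ξ ξ • z ∈
      (Submodule.span ℂ (Set.range fun x : B => ketBra ξ (η x) • (x : E))).topologicalClosure := by
  set M := (Submodule.span ℂ (Set.range fun x : B => ketBra ξ (η x) • (x : E))).topologicalClosure
  have act_act_mem (a : CompactOp H) {x : E} (hx : x ∈ B) : ketBra ξ ξ • a • x ∈ M := by
    rw [ketBra_act_act (norm_η x hx) (inner_self x hx)]
    exact M.smul_mem _ (Submodule.le_topologicalClosure _ (Submodule.subset_span ⟨⟨x, hx⟩, rfl⟩))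
  refine map_mem_of_mem_topologicalClosure_span (act (ketBra ξ ξ))
    (Submodule.isClosed_topologicalClosure _) ?_ (hB.dense_span.ge hz)
  rintro x (hx | ⟨a, x, hx, rfl⟩)
  · have mem := act_act_mem (inner (CompactOp H) x x) hx
    rwa [inner_self_act_self (hB.basic _ hx).1.isIdempotentElem] at mem
  · exact act_act_mem a hx

theorem IsOrthonormalBasis.nonempty_hilbertBasis {B : Set E}
    (hB : IsOrthonormalBasis (CompactOp H) X B) (hX : ∀ (a : CompactOp H), ∀ x ∈ X, a • x ∈ X)
    [CompleteSpace (corner (ketBra (ξ : H) ξ) X)] :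
    Nonempty (HilbertBasis B ℂ (corner (ketBra (ξ : H) ξ) X)) := by
  choose! η norm_η inner_self using fun x (hx : x ∈ B) => (hB.basic x hx).exists_eq_ketBra
  let v (x : B) : corner (ketBra (ξ : H) ξ) X := ⟨ketBra (ξ : H) (η x) • (x : E),
    act_mem_corner (ketBra_mul_ketBra (norm_eq_of_mem_sphere ξ) _ _) hX (hB.mem x.2)⟩
  have inner_v (x y : B) : inner (CompactOp H) (v x : E) (v y : E) =
      ketBra (ξ : H) (η y) * inner (CompactOp H) (x : E) (y : E) * ketBra (η x) (ξ : H) := by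
    rw [inner_act_act, star_ketBra]
  have orthonormal_v : Orthonormal ℂ v := by
    refine orthonormal_corner_iff.2 ⟨fun x => ?_, fun x y ne => ?_⟩
    · rw [inner_v, inner_self x x.2, ketBra_mul_ketBra (norm_η x x.2),
        ketBra_mul_ketBra (norm_η x x.2)]
    · exact (inner_v x y).trans <| by
        rw [hB.orthogonal x x.2 y y.2 (Subtype.coe_injective.ne ne), mul_zero, zero_mul]
  have range_v : Submodule.subtype _ '' Set.range v =
      Set.range fun x : B => ketBra (ξ : H) (η x) • (x : E) := (Set.range_comp _ _).symm
  refine ⟨HilbertBasis.mk orthonormal_v fun z _ => closure_subtype.2 ?_⟩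
  have z_mem := hB.ketBra_act_mem norm_η inner_self ξ (mem_corner.1 z.2).1
  rwa [(mem_corner.1 z.2).2, ← range_v, ← Submodule.map_span] at z_mem

theorem hasOrthonormalDim_finrank_corner (ξ : Metric.sphere (0 : H) 1)
    (hXc : IsClosed (X : Set E)) (hX : ∀ (a : CompactOp H), ∀ x ∈ X, a • x ∈ X)
    [FiniteDimensional ℂ (corner (ketBra (ξ : H) ξ) X)] :
    HasOrthonormalDim (CompactOp H) X (Module.finrank ℂ (corner (ketBra (ξ : H) ξ) X)) := by
  have : CompleteSpace (corner (ketBra (ξ : H) ξ) X) := FiniteDimensional.complete ℂ _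
  obtain ⟨w, b, -⟩ := exists_hilbertBasis ℂ (corner (ketBra (ξ : H) ξ) X)
  refine ⟨⟨_, isOrthonormalBasis_range_hilbertBasis hXc hX b⟩, fun B hB => ?_⟩
  obtain ⟨b⟩ := hB.nonempty_hilbertBasis (ξ := ξ) hX
  exact mk_eq_finrank_of_hilbertBasis b

variable [CompleteSpace E]

theorem exists_hasOrthonormalDim (hXc : IsClosed (X : Set E))
    (hX : ∀ (a : CompactOp H), ∀ x ∈ X, a • x ∈ X) {k : E →L[ℂ] E}
    (hk : k ∈ moduleCompacts (CompactOp H) E) (hkX : ∀ x ∈ X, k x = x) :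
    ∃ n : ℕ, HasOrthonormalDim (CompactOp H) X n := by
  rcases subsingleton_or_nontrivial H with _ | _
  · have : Subsingleton (CompactOp H) := ⟨fun a b => CompactOp.ext fun x => Subsingleton.elim _ _⟩
    exact ⟨0, Nat.cast_zero (R := Cardinal) ▸ hasOrthonormalDim_zero_of_subsingleton X⟩
  · obtain ⟨ξ, norm_ξ⟩ := exists_norm_eq H zero_le_one
    have := finiteDimensional_corner ξ hXc hk hkX
    exact ⟨_, hasOrthonormalDim_finrank_corner ⟨ξ, mem_sphere_zero_iff_norm.2 norm_ξ⟩ hXc hX⟩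

theorem Adjointable.IsFredholm.exists_hasOrthonormalDim_ker {T : Adjointable (CompactOp H) E}
    (hT : T.IsFredholm) :
    ∃ n : ℕ, HasOrthonormalDim (CompactOp H) (LinearMap.ker (T.op : E →ₗ[ℂ] E)) n := by
  obtain ⟨⟨S, hS⟩, -⟩ := hT
  refine exists_hasOrthonormalDim T.op.isClosed_ker (fun a x hx => ?_) (Submodule.neg_mem _ hS)
    fun x hx => ?_
  · have T_x : T.op x = 0 := hx
    exact (T.op_act a x).trans (T_x ▸ map_zero (act a))
  · have T_x : T.op x = 0 := hx
    simp [T_x]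

end Dimension

end HilbertModule

end

theorem mainTheorem3
    {H : Type*} [NormedAddCommGroup H] [InnerProductSpace ℂ H] [CompleteSpace H]
    {E : Type*} [NormedAddCommGroup E] [NormedSpace ℂ E] [CompleteSpace E]
    [SMul (HilbertModule.CompactOp H) E] [CStarModule (HilbertModule.CompactOp H) E]
    (t : E →ₗ.[ℂ] E)
    (ht : HilbertModule.IsRegular (HilbertModule.CompactOp H) t)
    (htF : HilbertModule.IsFredholm (HilbertModule.CompactOp H) t) :
    ∃ F : HilbertModule.Adjointable (HilbertModule.CompactOp H) E,
      -- `F = F_t` is the bounded transform of `t`, and `F⋆` is that of `t⋆`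
      HilbertModule.IsBoundedTransform t F ∧
      (∀ F' : HilbertModule.Adjointable (HilbertModule.CompactOp H) E,
        HilbertModule.IsBoundedTransform t F' → F' = F) ∧
      HilbertModule.IsBoundedTransform
        (HilbertModule.padjoint (HilbertModule.CompactOp H) t) F.conj ∧
      F.IsFredholm ∧
      -- equality of the kernels
      HilbertModule.pker t = LinearMap.ker (F.op : E →ₗ[ℂ] E) ∧
      HilbertModule.pker (HilbertModule.padjoint (HilbertModule.CompactOp H) t) =
        LinearMap.ker (F.conj.op : E →ₗ[ℂ] E) ∧
      -- the dimensions of the kernels are well defined and finite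
      (∃ m n : ℕ,
        HilbertModule.HasOrthonormalDim (HilbertModule.CompactOp H)
          (HilbertModule.pker t) m ∧
        HilbertModule.HasOrthonormalDim (HilbertModule.CompactOp H)
          (HilbertModule.pker (HilbertModule.padjoint (HilbertModule.CompactOp H) t)) n) ∧
      -- equality of the indices
      HilbertModule.index (HilbertModule.CompactOp H) t = F.index := by
  obtain ⟨Q, F, transform⟩ := ht.exists_isTransformPair
  obtain ⟨Q', transform'⟩ := transform.exists_padjoint ht.dense_domain
  have isFredholm := transform.isFredholm ht.isClosed htF
  have ker_eq := transform.pker_eq_ker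
  have ker_adj_eq := transform'.pker_eq_ker
  obtain ⟨m, hm⟩ := isFredholm.exists_hasOrthonormalDim_ker
  obtain ⟨n, hn⟩ := isFredholm.conj.exists_hasOrthonormalDim_ker
  refine ⟨F, (transform.isBoundedTransform_iff ht.dense_domain).2 rfl,
    fun F' => (transform.isBoundedTransform_iff ht.dense_domain).1,
    (transform'.isBoundedTransform_iff ht.dense_adjoint_domain).2 rfl,
    isFredholm, ker_eq, ker_adj_eq, ⟨m, n, ker_eq ▸ hm, ker_adj_eq ▸ hn⟩, ?_⟩
  rw [HilbertModule.index, HilbertModule.Adjointable.index, ker_eq, ker_adj_eq]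
  rfl
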